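/- Let $d\ge 1$, let $\mu=(\mu_1,\dots,\mu_{\ell(\mu)})$ and $\nu=(\nu_1,\dots,\nu_{\ell(\nu)})$ be ordered partitions of $d$ (finite sequences of positive integers with sum $d$), let $g\ge 0$ be an integer, and put $b=2g-2+\ell(\mu)+\ell(\nu)$. A \emph{Hurwitz galaxy} of type $(g,\mu,\nu)$ is a graph $G$ (loops and multiple edges allowed) on a closed connected oriented surface $S$ of genus $g$ such that (i) $S\setminus G$ is a disjoint union of open disks (the faces); (ii) there are $\ell(\mu)$ white faces, labelled $1,\dots,\ell(\mu)$, and $\ell(\nu)$ black faces, labelled $1,\dots,\ell(\nu)$, and each edge has a white face on one side and a black face on the other; (iii) the boundary walk of the white face labelled $i$ (of the black face labelled $j$) passes through $\mu_i b$ (respectively $\nu_j b$) vertices, counted with multiplicity; (iv) the vertices are labelled by $1,\dots,b$, and these labels appear cyclically in this order counterclockwise along the boundary of each white face; (v) for each $i\in\{1,\dots,b\}$ there are exactly $d-2$ vertices of valency $2$ and exactly one vertex of valency $4$ with label $i$, and there are no other vertices. Isomorphisms are orientation-preserving isomorphisms of embedded graphs that respect all labels and colours; embedded graphs are encoded, as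 usual, by their oriented edges, with the counterclockwise rotation at the vertices and the reversal of edges, and $\mathrm{Aut}(G)$ is the finite group of automorphisms of this structure. A face is a \emph{loop face} if at most one $4$-valent vertex lies on its boundary, and $G$ is \emph{bi-pruned} if it has no loop faces. Let $$Ph_g(\mu,\nu)=\sum_{[G]}\frac{1}{|\mathrm{Aut}(G)|},$$ the sum being over the isomorphism classes of bi-pruned Hurwitz galaxies of type $(g,\mu,\nu)$. A \emph{factorisation} of type $(g,\mu,\nu)$ is a tuple $(\sigma_1,\tau_1,\dots,\tau_b,\sigma_2)$ of permutations in $S_d$ such that each $\tau_i$ is a transposition, $\tau_b\cdots\tau_1\sigma_1=\sigma_2$, and the group generated by $\sigma_1,\tau_1,\dots,\tau_b,\sigma_2$ acts transitively on $\{1,\dots,d\}$, together with a labelling of the disjoint cycles of $\sigma_1$ by $1,\dots,\ell(\mu)$ and of $\sigma_2$ by $1,\dots,\ell(\nu)$ (fixed points count as cycles) such that the cycle $\sigma_1^i$ with label $i$ has length $\mu_i$ and the cycle $\sigma_2^j$ with label $j$ has length $\nu_j$. Put $\eta_0=\sigma_1$, $\eta_i=\tau_i\cdots\tau_1\sigma_1$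 and $\pi_i=\eta_{i-1}^{-1}\eta_i$ for $1\le i\le b$, so that $\sigma_1\pi_1\cdots\pi_b=\sigma_2$. Let $\mathrm{supp}(\tau)$ be the set of points moved by a transposition $\tau$, and let the support of a labelled cycle be the set of all its elements (one element for a fixed point). The factorisation is \emph{bi-pruned} if for each $i\in\{1,\dots,\ell(\mu)\}$ there are at least two indices $j$ with $\mathrm{supp}(\tau_j)\cap\mathrm{supp}(\sigma_1^i)\ne\emptyset$, and for each $i\in\{1,\dots,\ell(\nu)\}$ there are at least two indices $j$ with $\mathrm{supp}(\pi_j)\cap\mathrm{supp}(\sigma_2^i)\ne\emptyset$. Let $F^{bi}(g,\mu,\nu)$ be the set of bi-pruned factorisations of type $(g,\mu,\nu)$. Then $$Ph_g(\mu,\nu)=\frac{1}{d!}\,\bigl|F^{bi}(g,\mu,\nu)\bigr|.$$ -/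

import Mathlib

open Equiv

/-- The number `b = 2g - 2 + ℓ(μ) + ℓ(ν)`. (For `d > 0` both lengths are at least `1`, so the
subtraction does not truncate.) -/
def simpleCount {d : ℕ} (g : ℕ) (μ ν : Composition d) : ℕ :=
  2 * g + μ.length + ν.length - 2

/-! ### Graphs on oriented surfaces

A graph on a closed oriented surface whose complement is a disjoint union of open disks, up to
orientation preserving homeomorphism, encoded as usual by its oriented edges (darts). -/

/-- An oriented map (ribbon graph). A dart is an edge together with a direction, and it leaves its
origin. `rot` sends a dart to the next dart with the same origin, in counterclockwise order;
`rev` reverses the direction of a dart. Loops and multiple edges are allowed. -/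
structure OrientedMap (D : Type) where
  rot : Perm D
  rev : Perm D
  rev_rev : ∀ e, rev (rev e) = e
  rev_ne : ∀ e, rev e ≠ e

namespace OrientedMap

variable {D : Type} (M : OrientedMap D)

/-- Sends a dart `e` to the dart that follows it on the boundary of the face on the left of `e`.
This walks along the boundary of that face counterclockwise (with the face on the left). -/
def next : Perm D := M.rot⁻¹ * M.rev

/-- Vertices: cycles of `rot`. -/
def Vertex : Type := Quotient (Perm.SameCycle.setoid M.rot)

/-- Edges: cycles of `rev`. -/
def Edge : Type := Quotient (Perm.SameCycle.setoid M.rev)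

/-- Faces: cycles of `next`. -/
def Face : Type := Quotient (Perm.SameCycle.setoid M.next)

/-- The origin of a dart. -/
def origin (e : D) : M.Vertex := Quotient.mk _ e

/-- The face on the left of a dart. -/
def leftFace (e : D) : M.Face := Quotient.mk _ e

/-- The valency of a vertex (a loop counts twice). -/
noncomputable def valency (v : M.Vertex) : ℕ := Nat.card {e : D // M.origin e = v}

/-- The number of vertices on the boundary of a face, counted with multiplicity along the
boundary walk. -/
noncomputable def boundaryLength (f : M.Face) : ℕ := Nat.card {e : D // M.leftFace e = f}

/-- The vertex `v` lies on the boundary of the face `f`. -/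
def Incident (v : M.Vertex) (f : M.Face) : Prop := ∃ e : D, M.origin e = v ∧ M.leftFace e = f

/-- The underlying surface is (non-empty and) connected. -/
def IsConnected : Prop :=
  Nonempty D ∧ MulAction.IsPretransitive (Subgroup.closure {M.rot, M.rev}) D

/-- The underlying surface has genus `g`, through its Euler characteristic `V - E + F`. -/
def HasGenus (g : ℕ) : Prop :=
  (Nat.card M.Vertex : ℤ) - Nat.card M.Edge + Nat.card M.Face = 2 - 2 * g

end OrientedMap

/-! ### Hurwitz galaxies -/

/-- Hurwitz galaxies of type `(g, μ, ν)`. The labels `1, …, b` of the vertices and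
`1, …, ℓ(μ)`, `1, …, ℓ(ν)` of the faces are shifted to start from `0`. -/
structure HurwitzGalaxy {d : ℕ} (g : ℕ) (μ ν : Composition d) where
  Dart : Type
  finite_dart : Finite Dart
  map : OrientedMap Dart
  connected : map.IsConnected
  genus : map.HasGenus g
  /-- The colours and labels of the faces: the face with label `i` among the white faces is sent to
  `Sum.inl i`, the face with label `j` among the black faces is sent to `Sum.inr j`. -/
  faceLabel : map.Face ≃ Fin μ.length ⊕ Fin ν.length
  /-- Each edge has a white face on one side and a black face on the other. -/
  colour_rev : ∀ e : Dart, (faceLabel (map.leftFace (map.rev e))).isLeft ≠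
    (faceLabel (map.leftFace e)).isLeft
  boundary_white : ∀ i : Fin μ.length,
    map.boundaryLength (faceLabel.symm (Sum.inl i)) = μ.blocksFun i * simpleCount g μ ν
  boundary_black : ∀ j : Fin ν.length,
    map.boundaryLength (faceLabel.symm (Sum.inr j)) = ν.blocksFun j * simpleCount g μ ν
  vertexLabel : map.Vertex → Fin (simpleCount g μ ν)
  /-- Counterclockwise along the boundary of a white face the labels run cyclically through
  `1, …, b`. -/
  vertexLabel_next : ∀ e : Dart, (faceLabel (map.leftFace e)).isLeft = true →
    vertexLabel (map.origin (map.next e)) = finRotate _ (vertexLabel (map.origin e))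
  valency_eq : ∀ v : map.Vertex, map.valency v = 2 ∨ map.valency v = 4
  /-- There are `d - 2` two-valent vertices of each label. -/
  card_two_valent : ∀ i : Fin (simpleCount g μ ν),
    Nat.card {v : map.Vertex // vertexLabel v = i ∧ map.valency v = 2} + 2 = d
  /-- There is one four-valent vertex of each label. -/
  card_four_valent : ∀ i : Fin (simpleCount g μ ν),
    Nat.card {v : map.Vertex // vertexLabel v = i ∧ map.valency v = 4} = 1

namespace HurwitzGalaxy

variable {d g : ℕ} {μ ν : Composition d}

/-- Isomorphisms of Hurwitz galaxies: isomorphisms of the embedded graphs that preserve the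
orientation and all labels (and so the colours). -/
@[ext]
structure Iso (G H : HurwitzGalaxy g μ ν) where
  toEquiv : G.Dart ≃ H.Dart
  map_rot : ∀ e, toEquiv (G.map.rot e) = H.map.rot (toEquiv e)
  map_rev : ∀ e, toEquiv (G.map.rev e) = H.map.rev (toEquiv e)
  map_faceLabel : ∀ e, H.faceLabel (H.map.leftFace (toEquiv e)) = G.faceLabel (G.map.leftFace e)
  map_vertexLabel : ∀ e,
    H.vertexLabel (H.map.origin (toEquiv e)) = G.vertexLabel (G.map.origin e)

namespace Iso

def refl (G : HurwitzGalaxy g μ ν) : Iso G G where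
  toEquiv := Equiv.refl _
  map_rot _ := rfl
  map_rev _ := rfl
  map_faceLabel _ := rfl
  map_vertexLabel _ := rfl

def symm {G H : HurwitzGalaxy g μ ν} (φ : Iso G H) : Iso H G where
  toEquiv := φ.toEquiv.symm
  map_rot e := by rw [Equiv.symm_apply_eq, φ.map_rot, Equiv.apply_symm_apply]
  map_rev e := by rw [Equiv.symm_apply_eq, φ.map_rev, Equiv.apply_symm_apply]
  map_faceLabel e := by rw [← φ.map_faceLabel, Equiv.apply_symm_apply]
  map_vertexLabel e := by rw [← φ.map_vertexLabel, Equiv.apply_symm_apply]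

def trans {G H K : HurwitzGalaxy g μ ν} (φ : Iso G H) (ψ : Iso H K) : Iso G K where
  toEquiv := φ.toEquiv.trans ψ.toEquiv
  map_rot e := by simp [φ.map_rot, ψ.map_rot]
  map_rev e := by simp [φ.map_rev, ψ.map_rev]
  map_faceLabel e := by simp [φ.map_faceLabel, ψ.map_faceLabel]
  map_vertexLabel e := by simp [φ.map_vertexLabel, ψ.map_vertexLabel]

end Iso

/-- The order of the automorphism group. -/
noncomputable def autCard (G : HurwitzGalaxy g μ ν) : ℕ := Nat.card (Iso G G)

theorem autCard_eq {G H : HurwitzGalaxy g μ ν} (φ : Iso G H) : G.autCard = H.autCard :=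
  Nat.card_congr
    { toFun := fun α => (φ.symm.trans α).trans φ
      invFun := fun β => (φ.trans β).trans φ.symm
      left_inv := fun α => by ext e; simp [Iso.trans, Iso.symm]
      right_inv := fun β => by ext e; simp [Iso.trans, Iso.symm] }

/-- A loop face: a face that is adjacent to at most one four-valent vertex. -/
def IsLoopFace (G : HurwitzGalaxy g μ ν) (f : G.map.Face) : Prop :=
  {v : G.map.Vertex | G.map.valency v = 4 ∧ G.map.Incident v f}.Subsingleton

/-- A bi-pruned Hurwitz galaxy: one without loop faces. -/
def IsBiPruned (G : HurwitzGalaxy g μ ν) : Prop := ∀ f : G.map.Face, ¬ G.IsLoopFace f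

end HurwitzGalaxy

/-- Isomorphism as an equivalence relation on the bi-pruned Hurwitz galaxies of type `(g, μ, ν)`. -/
def biPrunedSetoid {d : ℕ} (g : ℕ) (μ ν : Composition d) :
    Setoid {G : HurwitzGalaxy g μ ν // G.IsBiPruned} where
  r G H := Nonempty (HurwitzGalaxy.Iso G.1 H.1)
  iseqv :=
    { refl := fun G => ⟨HurwitzGalaxy.Iso.refl G.1⟩
      symm := fun ⟨φ⟩ => ⟨φ.symm⟩
      trans := fun ⟨φ⟩ ⟨ψ⟩ => ⟨φ.trans ψ⟩ }

/-- Isomorphism classes of bi-pruned Hurwitz galaxies of type `(g, μ, ν)`. -/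
def BiPrunedClass {d : ℕ} (g : ℕ) (μ ν : Composition d) : Type 1 :=
  Quotient (biPrunedSetoid g μ ν)

/-- The order of the automorphism group of any galaxy in the class. -/
noncomputable def BiPrunedClass.autCard {d g : ℕ} {μ ν : Composition d} :
    BiPrunedClass g μ ν → ℕ :=
  Quotient.lift (fun G => G.1.autCard) fun _ _ ⟨φ⟩ => HurwitzGalaxy.autCard_eq φ

theorem HurwitzGalaxy.card_dart {d g : ℕ} {μ ν : Composition d} (G : HurwitzGalaxy g μ ν) :
    Nat.card G.Dart = d * simpleCount g μ ν + d * simpleCount g μ ν := by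
  have := G.finite_dart
  have h1 : Nat.card G.Dart =
      Nat.card (Σ x : Fin μ.length ⊕ Fin ν.length,
        {e : G.Dart // G.map.leftFace e = G.faceLabel.symm x}) :=
    Nat.card_congr
      ((Equiv.sigmaFiberEquiv (fun e => G.faceLabel (G.map.leftFace e))).symm.trans
        (Equiv.sigmaCongrRight fun x => Equiv.subtypeEquivRight fun e => by
          rw [Equiv.eq_symm_apply]))
  have hw : ∀ i, Nat.card {e : G.Dart // G.map.leftFace e = G.faceLabel.symm (Sum.inl i)} = _ :=
    G.boundary_white
  have hb : ∀ j, Nat.card {e : G.Dart // G.map.leftFace e = G.faceLabel.symm (Sum.inr j)} = _ :=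
    G.boundary_black
  rw [h1, Nat.card_sigma, Fintype.sum_sum_type]
  simp only [hw, hb, ← Finset.sum_mul, Composition.sum_blocksFun]

/-- There are only finitely many isomorphism classes. -/
instance BiPrunedClass.finite {d : ℕ} (g : ℕ) (μ ν : Composition d) :
    Finite (BiPrunedClass g μ ν) := by
  have key : ∀ G : HurwitzGalaxy g μ ν,
      Nonempty (G.Dart ≃ Fin (d * simpleCount g μ ν + d * simpleCount g μ ν)) := fun G => by
    have := G.finite_dart
    exact ⟨Finite.equivFinOfCardEq G.card_dart⟩
  let N := d * simpleCount g μ ν + d * simpleCount g μ ν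
  let c : ∀ G : HurwitzGalaxy g μ ν, G.Dart ≃ Fin N := fun G => (key G).some
  let F : BiPrunedClass g μ ν → (Fin N → Fin N) × (Fin N → Fin N) ×
      (Fin N → Fin μ.length ⊕ Fin ν.length) × (Fin N → Fin (simpleCount g μ ν)) := fun q =>
    let G := (Quotient.out q).1
    (fun x => c G (G.map.rot ((c G).symm x)), fun x => c G (G.map.rev ((c G).symm x)),
      fun x => G.faceLabel (G.map.leftFace ((c G).symm x)),
      fun x => G.vertexLabel (G.map.origin ((c G).symm x)))
  refine Finite.of_injective F fun q r h => ?_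
  rw [← Quotient.out_eq q, ← Quotient.out_eq r]
  refine Quotient.sound ⟨?_⟩
  simp only [F, Prod.mk.injEq] at h
  obtain ⟨h1, h2, h3, h4⟩ := h
  generalize (Quotient.out q).1 = G at *
  generalize (Quotient.out r).1 = H at *
  exact
    { toEquiv := (c G).trans (c H).symm
      map_rot := fun e => by simpa [Equiv.symm_apply_eq] using congrFun h1 (c G e)
      map_rev := fun e => by simpa [Equiv.symm_apply_eq] using congrFun h2 (c G e)
      map_faceLabel := fun e => by simpa using (congrFun h3 (c G e)).symm
      map_vertexLabel := fun e => by simpa using (congrFun h4 (c G e)).symm }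

noncomputable instance BiPrunedClass.fintype {d : ℕ} (g : ℕ) (μ ν : Composition d) :
    Fintype (BiPrunedClass g μ ν) := Fintype.ofFinite _

/-- The bi-pruned double Hurwitz number `Ph_g(μ, ν)`. -/
noncomputable def biPrunedHurwitz {d : ℕ} (g : ℕ) (μ ν : Composition d) : ℚ :=
  ∑ q : BiPrunedClass g μ ν, 1 / (q.autCard : ℚ)

/-! ### Factorisations in the symmetric group -/

/-- The disjoint cycles of `σ` (fixed points included) are labelled so that the `i`-th one has
length `μ i`: `label x` is the label of the cycle that contains `x`. In particular the cycle type
of `σ` is `μ`. -/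
structure IsCycleLabelling {d : ℕ} (σ : Perm (Fin d)) (μ : Composition d)
    (label : Fin d → Fin μ.length) : Prop where
  eq_iff : ∀ x y, label x = label y ↔ σ.SameCycle x y
  card_eq : ∀ i, Nat.card {x // label x = i} = μ.blocksFun i

/-- `η_i = τ_i ⋯ τ_1 σ₁`. -/
def partialProd {d b : ℕ} (σ₁ : Perm (Fin d)) (τ : Fin b → Perm (Fin d)) (i : ℕ) :
    Perm (Fin d) :=
  ((List.ofFn τ).take i).reverse.prod * σ₁

/-- Factorisations of type `(g, μ, ν)`, with their labelled cycles; `τ i` is `τ_{i+1}`. -/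
structure Factorisation {d : ℕ} (g : ℕ) (μ ν : Composition d) where
  σ₁ : Perm (Fin d)
  τ : Fin (simpleCount g μ ν) → Perm (Fin d)
  σ₂ : Perm (Fin d)
  label₁ : Fin d → Fin μ.length
  label₂ : Fin d → Fin ν.length
  labelling₁ : IsCycleLabelling σ₁ μ label₁
  labelling₂ : IsCycleLabelling σ₂ ν label₂
  swap : ∀ i, (τ i).IsSwap
  transitive : MulAction.IsPretransitive
    (Subgroup.closure ({σ₁, σ₂} ∪ Set.range τ)) (Fin d)
  prod_eq : (List.ofFn τ).reverse.prod * σ₁ = σ₂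

namespace Factorisation

variable {d g : ℕ} {μ ν : Composition d}

/-- The transpositions `π_i = η_{i-1}⁻¹ η_i` of the associated inverted factorisation. -/
def inv (f : Factorisation g μ ν) (j : Fin (simpleCount g μ ν)) : Perm (Fin d) :=
  (partialProd f.σ₁ f.τ j)⁻¹ * partialProd f.σ₁ f.τ (j + 1)

/-- Bi-pruned factorisations. The support of a labelled cycle is the set of all elements of that
cycle, also when it is a fixed point. -/
def IsBiPruned (f : Factorisation g μ ν) : Prop :=
  (∀ i : Fin μ.length, ∃ j k, j ≠ k ∧
    ({x | f.τ j x ≠ x} ∩ {x | f.label₁ x = i}).Nonempty ∧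
    ({x | f.τ k x ≠ x} ∩ {x | f.label₁ x = i}).Nonempty) ∧
  (∀ i : Fin ν.length, ∃ j k, j ≠ k ∧
    ({x | f.inv j x ≠ x} ∩ {x | f.label₂ x = i}).Nonempty ∧
    ({x | f.inv k x ≠ x} ∩ {x | f.label₂ x = i}).Nonempty)

instance : Finite (Factorisation g μ ν) :=
  Finite.of_injective (fun f => (f.σ₁, f.τ, f.σ₂, f.label₁, f.label₂)) fun f f' h => by
    cases f; cases f'; simpa using h

end Factorisation

/-- The set `F^{bi}(g, μ, ν)` of bi-pruned factorisations of type `(g, μ, ν)`. -/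
def biPrunedFactorisations {d : ℕ} (g : ℕ) (μ ν : Composition d) : Set (Factorisation g μ ν) :=
  {f | f.IsBiPruned}

/-! ### Permutations -/

/-! A galaxy is a branched cover cut into `d` sheets, and a factorisation is its monodromy once the
sheets are numbered. Number the sheets by the base: the white darts whose origin has the last label.
Each white face is walked in blocks of `b` steps, so a white dart is a pair (sheet, label). The
permutation `σ₁` is the return map `next ^ b` of the base, and `τ k` is the action of `rot ∘ rot` on
the white darts with label `k`: trivial at two-valent vertices, a transposition at the four-valent
one. Walking along the black faces then returns to the last copy by `τ_b ⋯ τ_1 σ₁ = σ₂`, so white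
and black faces are the cycles of `σ₁` and `σ₂`.

Conversely, `monodromyMap` builds the map on `Fin d × Fin b` (white darts) and a second copy of it
(their reverses) from `σ₁` and `τ`, and `Factorisation.galaxy` checks the axioms. Starting from a
galaxy with a numbered base, `HurwitzGalaxy.factorisation` reads off the monodromy and
`factorisationIso` recovers the galaxy.

The count is a double count of pairs (factorisation `f`, isomorphism from the galaxy of `f` to `G`).
By `onBase_bijective` these pairs are the same as the `d!` numberings of the base of `G`. For fixed
`f` there are either none or `|Aut G|` isomorphisms. Hence each class `[G]` comes from `d! / |Aut
G|` factorisations (`card_galaxyClass_mul_autCard`), and summation gives the formula. The pruning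
conditions agree by `galaxy_isBiPruned_iff`: a four-valent vertex `j` lies on a white face when `τ
j` moves a point of its cycle, and on a black face when the conjugate `π_j` does. -/

theorem Equiv.Perm.SameCycle.apply_eq_of_invariant {α β : Type*} {f : Perm α} {F : α → β}
    (h : ∀ x, F (f x) = F x) {x y : α} (hxy : f.SameCycle x y) : F x = F y := by
  obtain ⟨i, rfl⟩ := hxy
  induction i using Int.induction_on with
  | zero => rfl
  | succ i ih => rw [add_comm, zpow_add, zpow_one, Perm.mul_apply, h, ih]
  | pred i ih =>
    rw [ih, ← h ((f ^ (-(i : ℤ) - 1)) x), ← Perm.mul_apply, ← zpow_one_add]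
    congr 3
    ring

/-- The group generated by `S` is transitive if and only if the only `S`-invariant equivalence
relation with `S`-invariant classes is the total one. -/
theorem isPretransitive_closure_iff {α : Type*} (S : Set (Perm α)) :
    MulAction.IsPretransitive (Subgroup.closure S) α ↔
      ∀ r : Setoid α, (∀ s ∈ S, ∀ x, r (s x) x) → ∀ x y, r x y := by
  constructor
  · intro h r hr x y
    obtain ⟨⟨g, hg⟩, rfl⟩ := h.exists_smul_eq y x
    change r (g y) y
    induction hg using Subgroup.closure_induction generalizing y with
    | mem s hs => exact hr s hs y
    | one => exact r.refl y
    | mul s t _ _ hs ht => exact r.trans (hs (t y)) (ht y)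
    | inv s _ hs => simpa using r.symm (hs (s⁻¹ y))
  · intro h
    refine ⟨fun x y => ?_⟩
    have := h (MulAction.orbitRel (Subgroup.closure S) α)
      (fun s hs z => ⟨⟨s, Subgroup.subset_closure hs⟩, rfl⟩) y x
    exact this

theorem minimalPeriod_eq_card_sameCycle {α : Type*} [Finite α] (f : Perm α) (x : α) :
    Function.minimalPeriod f x = Nat.card {y // f.SameCycle y x} := by
  classical
  have := Fintype.ofFinite α
  have h := MulAction.minimalPeriod_eq_card (a := f) (b := x)
  have h2 : Function.minimalPeriod f x = Function.minimalPeriod (f • ·) x := rfl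
  rw [h2, h, ← Nat.card_eq_fintype_card]
  refine Nat.card_congr (Equiv.subtypeEquivRight fun y => ?_)
  rw [Perm.sameCycle_comm]
  constructor
  · rintro ⟨⟨_, i, rfl⟩, rfl⟩
    exact ⟨i, rfl⟩
  · rintro ⟨i, rfl⟩
    exact ⟨⟨_, i, rfl⟩, rfl⟩

theorem val_finRotate {b : ℕ} (k : Fin b) :
    (finRotate b k : ℕ) = if (k : ℕ) + 1 < b then (k : ℕ) + 1 else 0 := by
  rcases b with _ | b
  · exact k.elim0
  · rw [coe_finRotate]
    have := k.isLt
    simp only [Fin.ext_iff, Fin.val_last]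
    split_ifs <;> omega

/-! ### Permutations of a tower of copies of a set -/

section Tower

variable {X : Type} {b : ℕ}

/-- The permutation of `b` cyclically arranged copies of `X` that maps each copy to the next one,
by `c k` if this is the copy number `k`. -/
def towerPerm (c : Fin b → Perm X) : Perm (X × Fin b) where
  toFun p := (c (finRotate b p.2) p.1, finRotate b p.2)
  invFun p := ((c p.2)⁻¹ p.1, (finRotate b)⁻¹ p.2)
  left_inv p := by simp [-finRotate_apply]
  right_inv p := by simp [-finRotate_apply, -finRotate_symm_apply]

theorem towerPerm_apply (c : Fin b → Perm X) (x : X) (k : Fin b) :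
    towerPerm c (x, k) = (c (finRotate b k) x, finRotate b k) := rfl

theorem towerPerm_inv_apply (c : Fin b → Perm X) (x : X) (k : Fin b) :
    (towerPerm c)⁻¹ (x, k) = ((c k)⁻¹ x, (finRotate b)⁻¹ k) := rfl

variable {c P : Fin b → Perm X} {l : Fin b}

/-- `P k` is the accumulated product of the steps into the copies `0, …, k`, and `l` is the last
copy. Climbing from `l` through copy `0` up to copy `k` applies exactly `P k`. -/
theorem towerPerm_sameCycle_base (h0 : ∀ k : Fin b, (k : ℕ) = 0 → P k = c k)
    (hs : ∀ k, (finRotate b k : ℕ) ≠ 0 → P (finRotate b k) = c (finRotate b k) * P k)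
    (hl : (finRotate b l : ℕ) = 0) (z : X) (k : Fin b) :
    (towerPerm c).SameCycle (z, l) (P k z, k) := by
  obtain ⟨k, hk⟩ := k
  induction k with
  | zero =>
    refine ⟨1, ?_⟩
    have h : finRotate b l = ⟨0, hk⟩ := Fin.ext hl
    rw [zpow_one, towerPerm_apply, h, h0 _ rfl]
  | succ k ih =>
    refine (ih (by omega)).trans ⟨1, ?_⟩
    have h : finRotate b ⟨k, by omega⟩ = ⟨k + 1, hk⟩ := Fin.ext (by rw [val_finRotate, if_pos hk])
    have h' := hs ⟨k, by omega⟩ (by rw [h]; exact Nat.succ_ne_zero k)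
    rw [h] at h'
    rw [zpow_one, towerPerm_apply, h, h', Perm.mul_apply]

/-- The cycles of a permutation of a tower are those of its first return map `P l` to the last
copy. -/
theorem towerPerm_sameCycle (h0 : ∀ k : Fin b, (k : ℕ) = 0 → P k = c k)
    (hs : ∀ k, (finRotate b k : ℕ) ≠ 0 → P (finRotate b k) = c (finRotate b k) * P k)
    (hl : (finRotate b l : ℕ) = 0) (p q : X × Fin b) :
    (towerPerm c).SameCycle p q ↔ (P l).SameCycle ((P p.2)⁻¹ p.1) ((P q.2)⁻¹ q.1) := by
  have base := towerPerm_sameCycle_base h0 hs hl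
  constructor
  · intro h
    -- Pull each point back to its starting point in the last copy. This is constant along a climb
    -- and changes by one application of `P l` at the wrap from `l` to `0`.
    let F : X × Fin b → Quotient (Perm.SameCycle.setoid (P l)) :=
      fun p => Quotient.mk _ ((P p.2)⁻¹ p.1)
    refine Quotient.exact (h.apply_eq_of_invariant (F := F) ?_)
    rintro ⟨x, k⟩
    simp only [F, towerPerm_apply]
    by_cases hk : (finRotate b k : ℕ) = 0
    · obtain rfl : k = l := (finRotate b).injective (Fin.ext (hk.trans hl.symm))
      refine Quotient.sound ?_
      rw [h0 _ hk]
      exact ⟨-1, by simp⟩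
    · simp [hs k hk, -finRotate_apply]
  · intro h
    have h1 : ∀ p : X × Fin b, (towerPerm c).SameCycle ((P p.2)⁻¹ p.1, l) p := fun p => by
      simpa using base ((P p.2)⁻¹ p.1) p.2
    refine (h1 p).symm.trans (Perm.SameCycle.trans ?_ (h1 q))
    let F : X → Quotient (Perm.SameCycle.setoid (towerPerm c)) := fun x => Quotient.mk _ (x, l)
    exact Quotient.exact (h.apply_eq_of_invariant (F := F) fun x =>
      Quotient.sound (base x l).symm)

end Tower

/-! ### Maps with bipartite faces -/

namespace OrientedMap

/-- The map with the given permutations of the white and of the black darts along the boundary of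
their faces, where the black darts are the reversed white darts. The walk along the black
faces is clockwise. -/
def ofFaces {W : Type} (n m : Perm W) : OrientedMap (W ⊕ W) where
  rot := Equiv.sumComm W W * Equiv.sumCongr n⁻¹ m
  rev := Equiv.sumComm W W
  rev_rev e := by cases e <;> rfl
  rev_ne e := by cases e <;> simp

section OfFaces

variable {W : Type} (n m : Perm W) (w v : W)

@[simp] theorem ofFaces_rev_inl : (ofFaces n m).rev (Sum.inl w) = Sum.inr w := rfl
@[simp] theorem ofFaces_rev_inr : (ofFaces n m).rev (Sum.inr w) = Sum.inl w := rfl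
@[simp] theorem ofFaces_rot_inl : (ofFaces n m).rot (Sum.inl w) = Sum.inr (n⁻¹ w) := rfl
@[simp] theorem ofFaces_rot_inr : (ofFaces n m).rot (Sum.inr w) = Sum.inl (m w) := rfl

theorem ofFaces_next : (ofFaces n m).next = Perm.sumCongrHom W W (n, m⁻¹) := by
  ext e
  rw [next, Perm.mul_apply, Perm.inv_eq_iff_eq]
  cases e <;> simp

@[simp] theorem ofFaces_next_inl : (ofFaces n m).next (Sum.inl w) = Sum.inl (n w) := by
  simp [ofFaces_next]
@[simp] theorem ofFaces_next_inr : (ofFaces n m).next (Sum.inr w) = Sum.inr (m⁻¹ w) := by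
  simp [ofFaces_next]

theorem ofFaces_sameCycle_inl :
    (ofFaces n m).next.SameCycle (Sum.inl w) (Sum.inl v) ↔ n.SameCycle w v := by
  simp only [Perm.SameCycle, ofFaces_next, ← map_zpow, Prod.pow_mk]
  simp

theorem ofFaces_sameCycle_inr :
    (ofFaces n m).next.SameCycle (Sum.inr w) (Sum.inr v) ↔ m.SameCycle w v := by
  rw [← Perm.sameCycle_inv (f := m)]
  simp only [Perm.SameCycle, ofFaces_next, ← map_zpow, Prod.pow_mk]
  simp

end OfFaces

variable {D : Type} (M : OrientedMap D)

theorem origin_eq_iff {M : OrientedMap D} {e e' : D} :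
    M.origin e = M.origin e' ↔ M.rot.SameCycle e e' := Quotient.eq

theorem leftFace_eq_iff {M : OrientedMap D} {e e' : D} :
    M.leftFace e = M.leftFace e' ↔ M.next.SameCycle e e' := Quotient.eq

@[simp] theorem origin_rot (e : D) : M.origin (M.rot e) = M.origin e :=
  origin_eq_iff.2 (Perm.sameCycle_apply_left.2 (Perm.SameCycle.refl _ _))

@[simp] theorem leftFace_next (e : D) : M.leftFace (M.next e) = M.leftFace e :=
  leftFace_eq_iff.2 (Perm.sameCycle_apply_left.2 (Perm.SameCycle.refl _ _))

theorem rot_next (e : D) : M.rot (M.next e) = M.rev e := by simp [next]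

theorem valency_origin [Finite D] (e : D) :
    M.valency (M.origin e) = Function.minimalPeriod M.rot e := by
  rw [minimalPeriod_eq_card_sameCycle, valency]
  simp only [origin_eq_iff]

theorem isConnected_iff : M.IsConnected ↔ Nonempty D ∧
    ∀ r : Setoid D, (∀ e, r (M.rot e) e) → (∀ e, r (M.rev e) e) → ∀ e e', r e e' := by
  rw [IsConnected, isPretransitive_closure_iff]
  simp

end OrientedMap

theorem partialProd_succ {d b : ℕ} (σ : Perm (Fin d)) (τ : Fin b → Perm (Fin d)) (k : Fin b) :
    partialProd σ τ (k + 1) = τ k * partialProd σ τ k := by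
  simp [partialProd, List.take_add_one, mul_assoc]

theorem partialProd_zero {d b : ℕ} (σ : Perm (Fin d)) (τ : Fin b → Perm (Fin d)) :
    partialProd σ τ 0 = σ := by
  simp [partialProd]

theorem partialProd_length {d b : ℕ} (σ : Perm (Fin d)) (τ : Fin b → Perm (Fin d)) :
    partialProd σ τ b = (List.ofFn τ).reverse.prod * σ := by
  rw [partialProd, List.take_of_length_le (by simp)]

theorem minimalPeriod_eq_two {α : Type*} {f : α → α} {x : α} (h : f x ≠ x) (h' : f (f x) = x) :
    Function.minimalPeriod f x = 2 :=
  Function.minimalPeriod_eq_prime_pow (p := 2) (k := 0) h h'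

theorem minimalPeriod_eq_four {α : Type*} {f : α → α} {x : α} (h : f (f x) ≠ x)
    (h' : f (f (f (f x))) = x) : Function.minimalPeriod f x = 4 :=
  Function.minimalPeriod_eq_prime_pow (p := 2) (k := 1) h h'

theorem Equiv.Perm.IsSwap.apply_apply {α : Type*} [DecidableEq α] {τ : Perm α} (h : τ.IsSwap)
    (x : α) : τ (τ x) = x := by
  obtain ⟨a, a', -, rfl⟩ := h
  simp

theorem Equiv.Perm.IsSwap.card_fixed {d : ℕ} {τ : Perm (Fin d)} (h : τ.IsSwap) :
    Nat.card {x // τ x = x} + 2 = d := by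
  have h1 := Finset.card_filter_add_card_filter_not (s := (Finset.univ : Finset (Fin d)))
    (fun x => τ x = x)
  have h2 : Finset.card {x | ¬ τ x = x} = 2 := Perm.card_support_eq_two.2 h
  rw [h2, Finset.card_univ, Fintype.card_fin] at h1
  rw [Nat.card_eq_fintype_card, Fintype.card_subtype, h1]

/-! ### The map with given monodromy -/

section Monodromy

variable {X : Type} {b : ℕ}

/-- `σ` at the step into the first copy, the identity at the other steps. -/
def firstStep (σ : Perm X) (k : Fin b) : Perm X := if (k : ℕ) = 0 then σ else 1

/-- The map whose white darts are `b` copies of `X`, with monodromy `σ` around the white faces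
and `τ k` at the vertices with label `k`. -/
def monodromyMap (σ : Perm X) (τ : Fin b → Perm X) : OrientedMap ((X × Fin b) ⊕ (X × Fin b)) :=
  .ofFaces (towerPerm (firstStep σ)) (towerPerm fun k => τ k * firstStep σ k)

/-- The label of the origin of a dart. -/
def monodromyLabel : (X × Fin b) ⊕ (X × Fin b) → Fin b :=
  Sum.elim (fun p => p.2) fun p => finRotate b p.2

variable (σ : Perm X) (τ : Fin b → Perm X)

/-- Two turns go one step back along a white face and one step forward along a black face. The
factors `firstStep σ k` cancel, which leaves `τ k`. -/
theorem monodromyMap_rot_rot (x : X) (k : Fin b) :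
    (monodromyMap σ τ).rot ((monodromyMap σ τ).rot (.inl (x, k))) = .inl (τ k x, k) := by
  simp [monodromyMap, towerPerm_apply, towerPerm_inv_apply, -finRotate_apply,
    -finRotate_symm_apply]

theorem monodromyMap_rot_isLeft (e : (X × Fin b) ⊕ (X × Fin b)) :
    ((monodromyMap σ τ).rot e).isLeft = !e.isLeft := by
  cases e <;> simp [monodromyMap]

theorem monodromyLabel_rot (e : (X × Fin b) ⊕ (X × Fin b)) :
    monodromyLabel ((monodromyMap σ τ).rot e) = monodromyLabel e := by
  rcases e with ⟨x, k⟩ | ⟨x, k⟩ <;>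
  simp [monodromyMap, monodromyLabel, towerPerm_apply, towerPerm_inv_apply, -finRotate_apply,
    -finRotate_symm_apply]

theorem monodromyLabel_next (p : X × Fin b) :
    monodromyLabel ((monodromyMap σ τ).next (.inl p)) = finRotate b p.2 := by
  simp only [monodromyMap, monodromyLabel, OrientedMap.ofFaces_next_inl, Sum.elim_inl]
  rfl

theorem monodromyMap_exists_origin_inl (v : (monodromyMap σ τ).Vertex) :
    ∃ p, (monodromyMap σ τ).origin (.inl p) = v := by
  obtain ⟨p | p, rfl⟩ := Quotient.exists_rep v
  · exact ⟨p, rfl⟩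
  · refine ⟨_, (monodromyMap σ τ).origin_rot (.inr p)⟩

/-- Only the step into copy `0` is non-trivial, so all accumulated products equal `σ` and the copy
number plays no role. -/
theorem monodromyMap_leftFace_inl (hb : 0 < b) (p q : X × Fin b) :
    (monodromyMap σ τ).next.SameCycle (.inl p) (.inl q) ↔ σ.SameCycle p.1 q.1 := by
  rw [monodromyMap, OrientedMap.ofFaces_sameCycle_inl,
    towerPerm_sameCycle (P := fun _ => σ) (l := ⟨b - 1, by omega⟩)]
  · simp
  · intro k hk
    simp [firstStep, hk]
  · intro k hk
    simp only [firstStep, if_neg hk, one_mul]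
  · rw [val_finRotate, if_neg (by simp; omega)]

variable {d : ℕ} (s : Perm (Fin d)) (t : Fin b → Perm (Fin d))

theorem monodromyMap_leftFace_inr (hb : 0 < b) (p q : Fin d × Fin b) :
    (monodromyMap s t).next.SameCycle (.inr p) (.inr q) ↔ (partialProd s t b).SameCycle
      ((partialProd s t (p.2 + 1))⁻¹ p.1) ((partialProd s t (q.2 + 1))⁻¹ q.1) := by
  rw [monodromyMap, OrientedMap.ofFaces_sameCycle_inr,
    -- The index is `k + 1` because the step into copy `k` already includes `t k`; the return to
    -- copy `b - 1` is the full product.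
    towerPerm_sameCycle (P := fun k => partialProd s t (k + 1)) (l := ⟨b - 1, by omega⟩)]
  · simp only [Nat.sub_add_cancel hb]
  · intro k hk
    simp only [partialProd_succ, firstStep, if_pos hk]
    rw [hk, partialProd_zero]
  · intro k hk
    simp only [partialProd_succ _ _ (finRotate b k), firstStep, if_neg hk, mul_one]
    rw [val_finRotate] at hk ⊢
    split_ifs at hk ⊢
    · rfl
    · exact absurd rfl hk
  · rw [val_finRotate, if_neg (by simp; omega)]

theorem monodromyMap_not_sameCycle (p q : X × Fin b) :
    ¬ (monodromyMap σ τ).next.SameCycle (.inl p) (.inr q) := fun h => by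
  have := h.apply_eq_of_invariant (F := Sum.isLeft) (by rintro (e | e) <;> simp [monodromyMap])
  simp at this

variable {τ}

theorem monodromyMap_origin_inl (h : ∀ k x, τ k (τ k x) = x) {x y : X} {k l : Fin b} :
    (monodromyMap σ τ).origin (.inl (x, k)) = (monodromyMap σ τ).origin (.inl (y, l)) ↔
      k = l ∧ (y = x ∨ y = τ k x) := by
  constructor
  · intro he
    -- A vertex is recognised by its label and the pair `{x, τ k x}`. A black dart takes the value
    -- of the white dart that `rot` sends it to, so the branch with `∅` is a dummy.
    let F : (X × Fin b) ⊕ (X × Fin b) → Set X × Fin b := Sum.elim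
      (fun p => ({p.1, τ p.2 p.1}, p.2)) fun p =>
        Sum.elim (fun p => ({p.1, τ p.2 p.1}, p.2)) (fun p => (∅, p.2))
          ((monodromyMap σ τ).rot (.inr p))
    have := (OrientedMap.origin_eq_iff.1 he).apply_eq_of_invariant (F := F) (by
      rintro (⟨x, k⟩ | p)
      · have h1 : (monodromyMap σ τ).rot (.inl (x, k)) =
          .inr ((towerPerm (firstStep σ))⁻¹ (x, k)) := rfl
        have h2 := monodromyMap_rot_rot σ τ x k
        rw [h1] at h2
        simp only [h1, F, Sum.elim_inr, h2, Sum.elim_inl, h, Set.pair_comm]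
      · simp [F, monodromyMap])
    simp only [F, Sum.elim_inl, Prod.mk.injEq] at this
    obtain ⟨h1, rfl⟩ := this
    refine ⟨rfl, ?_⟩
    have : y ∈ ({y, τ k y} : Set X) := Or.inl rfl
    rwa [← h1] at this
  · rintro ⟨rfl, rfl | rfl⟩
    · rfl
    · rw [← monodromyMap_rot_rot σ τ, OrientedMap.origin_rot, OrientedMap.origin_rot]

/-- `rot` alternates the colours and its square acts as the involution `τ k`, so the period is `2`
at fixed points and `4` elsewhere. -/
theorem monodromyMap_valency [Finite X] [DecidableEq X] (h : ∀ k x, τ k (τ k x) = x) (x : X)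
    (k : Fin b) :
    (monodromyMap σ τ).valency ((monodromyMap σ τ).origin (.inl (x, k))) =
      if τ k x = x then 2 else 4 := by
  rw [OrientedMap.valency_origin]
  split_ifs with hx
  · refine minimalPeriod_eq_two (fun h => ?_) (by rw [monodromyMap_rot_rot, hx])
    simpa [h] using monodromyMap_rot_isLeft σ τ (.inl (x, k))
  · refine minimalPeriod_eq_four ?_ ?_
    · simpa [monodromyMap_rot_rot] using hx
    · rw [monodromyMap_rot_rot, monodromyMap_rot_rot, h]

theorem monodromyMap_card_edge :
    Nat.card (monodromyMap σ τ).Edge = Nat.card (X × Fin b) := by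
  refine (Nat.card_congr (Equiv.ofBijective
    (fun p => (Quotient.mk _ (.inl p) : (monodromyMap σ τ).Edge))
    ⟨fun p q h => ?_, fun v => ?_⟩)).symm
  · exact (Quotient.exact h : Perm.SameCycle _ _ _).apply_eq_of_invariant (F := Sum.elim id id)
      (by rintro (e | e) <;> simp [monodromyMap])
  · obtain ⟨p | p, rfl⟩ := Quotient.exists_rep v
    · exact ⟨p, rfl⟩
    · exact ⟨p, Quotient.sound ⟨1, by simp [monodromyMap]⟩⟩

/-- The label of a vertex. -/
def monodromyVertexLabel : (monodromyMap σ τ).Vertex → Fin b :=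
  Quotient.lift monodromyLabel fun _ _ h =>
    Perm.SameCycle.apply_eq_of_invariant (monodromyLabel_rot σ τ) h

variable {t}

theorem monodromyMap_card_two_valent (h : ∀ k, (t k).IsSwap) (k : Fin b) :
    Nat.card {v : (monodromyMap s t).Vertex //
      monodromyVertexLabel s v = k ∧ (monodromyMap s t).valency v = 2} + 2 = d := by
  have h' := fun k => (h k).apply_apply
  refine (congrArg (· + 2) ?_).trans (h k).card_fixed
  refine (Nat.card_congr (Equiv.ofBijective (fun x => ⟨(monodromyMap s t).origin (.inl (x.1, k)),
    rfl, by rw [monodromyMap_valency s h', if_pos x.2]⟩) ⟨?_, ?_⟩)).symm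
  · rintro ⟨x, hx⟩ ⟨y, hy⟩ hxy
    rw [Subtype.mk.injEq, monodromyMap_origin_inl s h', hx, or_self] at hxy
    exact Subtype.ext hxy.2.symm
  · rintro ⟨v, hv, hv'⟩
    obtain ⟨⟨x, l⟩, rfl⟩ := monodromyMap_exists_origin_inl s t v
    obtain rfl : l = k := hv
    rw [monodromyMap_valency s h'] at hv'
    exact ⟨⟨x, by by_contra hx; simp [hx] at hv'⟩, rfl⟩

theorem monodromyMap_card_four_valent (h : ∀ k, (t k).IsSwap) (k : Fin b) :
    Nat.card {v : (monodromyMap s t).Vertex //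
      monodromyVertexLabel s v = k ∧ (monodromyMap s t).valency v = 4} = 1 := by
  have h' := fun k => (h k).apply_apply
  obtain ⟨a, a', ha, hk⟩ := h k
  rw [Nat.card_eq_one_iff_exists]
  refine ⟨⟨(monodromyMap s t).origin (.inl (a, k)), rfl, ?_⟩, ?_⟩
  · rw [monodromyMap_valency s h', if_neg]
    simpa [hk] using ha.symm
  · rintro ⟨v, hv, hv'⟩
    obtain ⟨⟨x, l⟩, rfl⟩ := monodromyMap_exists_origin_inl s t v
    obtain rfl : l = k := hv
    rw [monodromyMap_valency s h'] at hv'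
    refine Subtype.ext ((monodromyMap_origin_inl s h').2 ⟨rfl, ?_⟩)
    rw [hk] at hv' ⊢
    by_contra hx
    push Not at hx
    by_cases hx' : x = a'
    · subst hx'
      simp at hx
    · simp [swap_apply_of_ne_of_ne hx.1.symm hx'] at hv'

theorem monodromyMap_valency_eq (h : ∀ k, (t k).IsSwap) (v : (monodromyMap s t).Vertex) :
    (monodromyMap s t).valency v = 2 ∨ (monodromyMap s t).valency v = 4 := by
  obtain ⟨⟨x, l⟩, rfl⟩ := monodromyMap_exists_origin_inl s t v
  rw [monodromyMap_valency s fun k => (h k).apply_apply]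
  split_ifs <;> simp

/-- Each label has `d - 2` two-valent vertices and one four-valent vertex, so `d - 1` in all. -/
theorem monodromyMap_card_vertex (h : ∀ k, (t k).IsSwap) :
    Nat.card (monodromyMap s t).Vertex + b = d * b := by
  classical
  have hfin : Finite (monodromyMap s t).Vertex := Quotient.finite _
  have key : ∀ k, Nat.card {v : (monodromyMap s t).Vertex // monodromyVertexLabel s v = k} + 1
      = d := fun k => by
    have h2 := monodromyMap_card_two_valent s h k
    have : Nat.card {v : (monodromyMap s t).Vertex // monodromyVertexLabel s v = k} =
      Nat.card {v : (monodromyMap s t).Vertex //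
      monodromyVertexLabel s v = k ∧ (monodromyMap s t).valency v = 2} +
      Nat.card {v : (monodromyMap s t).Vertex //
      monodromyVertexLabel s v = k ∧ (monodromyMap s t).valency v = 4} := by
      rw [← Nat.card_sum]
      refine Nat.card_congr ((Equiv.subtypeEquivRight fun v => ?_).trans
        (subtypeOrEquiv _ _ ?_))
      · rw [← and_or_left]
        exact (and_iff_left (monodromyMap_valency_eq s h v)).symm
      · rw [Pi.disjoint_iff]
        intro v
        simp only [Prop.disjoint_iff]
        omega
    have h4 := monodromyMap_card_four_valent s h k
    omega
  rw [Nat.card_congr (Equiv.sigmaFiberEquiv (monodromyVertexLabel (τ := t) s)).symm,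
    Nat.card_sigma]
  have : ∑ _k : Fin b, d = d * b := by simp [mul_comm]
  rw [← this, ← Finset.sum_congr rfl fun k _ => key k, Finset.sum_add_distrib]
  simp

/-- Invariant relations on points and on darts determine each other. A relation on points pulls back
along the projection to the first coordinate. A relation on darts is invariant along white faces,
hence determined on copy `0`, where `rot ∘ rot` provides each `t k` and the white faces provide `s`.
-/
theorem monodromyMap_isConnected_iff (hb : 0 < b) :
    (monodromyMap s t).IsConnected ↔ Nonempty (Fin d) ∧ MulAction.IsPretransitive
      (Subgroup.closure ({s, (List.ofFn t).reverse.prod * s} ∪ Set.range t)) (Fin d) := by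
  rw [OrientedMap.isConnected_iff, isPretransitive_closure_iff]
  constructor
  · rintro ⟨⟨e⟩, H⟩
    refine ⟨⟨(Sum.elim Prod.fst Prod.fst e : Fin d)⟩, fun r hr x y => ?_⟩
    have hs : ∀ (k : Fin b) x, r (firstStep s k x) x := fun k x => by
      unfold firstStep
      split_ifs
      · exact hr s (by simp) x
      · exact r.refl _
    have := H (r.comap (Sum.elim Prod.fst Prod.fst)) ?_ ?_ (.inl (x, ⟨0, hb⟩)) (.inl (y, ⟨0, hb⟩))
    · exact this
    · rintro (⟨x, k⟩ | ⟨x, k⟩)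
      · have := r.symm (hs k ((firstStep s k)⁻¹ x))
        rwa [← Perm.mul_apply, mul_inv_cancel, Perm.one_apply] at this
      · exact r.trans (hr (t (finRotate b k)) (by simp) _) (hs _ _)
    · rintro (⟨x, k⟩ | ⟨x, k⟩) <;> exact r.refl _
  · rintro ⟨⟨x₀⟩, H⟩
    refine ⟨⟨.inl (x₀, ⟨0, hb⟩)⟩, fun r hrot hrev => ?_⟩
    have hnext : ∀ e, r ((monodromyMap s t).next e) e := fun e =>
      r.trans (r.symm (hrot _)) (by rw [OrientedMap.rot_next]; exact hrev e)
    have hface : ∀ p q : Fin d × Fin b, s.SameCycle p.1 q.1 → r (.inl p) (.inl q) :=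
      fun p q hpq => Quotient.exact
        (((monodromyMap_leftFace_inl s t hb p q).2 hpq).apply_eq_of_invariant
          (F := fun e => Quotient.mk r e) fun e => Quotient.sound (hnext e))
    have hs : ∀ x, r (.inl (s x, ⟨0, hb⟩)) (.inl (x, ⟨0, hb⟩)) := fun x =>
      hface _ _ (Perm.sameCycle_apply_left.2 (Perm.SameCycle.refl _ _))
    have ht : ∀ k x, r (.inl (t k x, ⟨0, hb⟩)) (.inl (x, ⟨0, hb⟩)) := fun k x => by
      refine r.trans (hface _ (t k x, k) (Perm.SameCycle.refl _ _))
        (r.trans ?_ (hface (x, k) _ (Perm.SameCycle.refl _ _)))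
      rw [← monodromyMap_rot_rot s t]
      exact r.trans (hrot _) (hrot _)
    have hprod : ∀ L : List (Perm (Fin d)), (∀ g ∈ L, g ∈ Set.range t) →
        ∀ x, r (.inl (L.prod x, ⟨0, hb⟩)) (.inl (x, ⟨0, hb⟩)) := fun L => by
      induction L with
      | nil => exact fun _ x => r.refl _
      | cons g L ih =>
        intro hL x
        obtain ⟨k, rfl⟩ := hL g (by simp)
        rw [List.prod_cons, Perm.mul_apply]
        exact r.trans (ht k _) (ih (fun g hg => hL g (by simp [hg])) x)
    have hbase := H (r.comap fun x => .inl (x, ⟨0, hb⟩)) (by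
      rintro g ((rfl | rfl) | ⟨k, rfl⟩) x
      · exact hs x
      · exact r.trans (hprod _ (by simp) _) (hs x)
      · exact ht k x)
    have hall : ∀ e, ∃ x, r e (.inl (x, ⟨0, hb⟩)) := by
      rintro (p | p)
      · exact ⟨p.1, hface _ _ (Perm.SameCycle.refl _ _)⟩
      · exact ⟨p.1, r.trans (hrev (.inl p)) (hface _ _ (Perm.SameCycle.refl _ _))⟩
    intro e e'
    obtain ⟨x, hx⟩ := hall e
    obtain ⟨y, hy⟩ := hall e'
    exact r.trans hx (r.trans (hbase x y) (r.symm hy))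

section FaceLabel

variable (t) {ι κ : Type} (u : Fin d → ι) (v : Fin d → κ)

/-- The colour and the label of the face on the left of a dart, for labellings `u` of the cycles
of the monodromy around the white faces and `v` of those around the black faces. -/
def monodromyFaceLabel : (Fin d × Fin b) ⊕ (Fin d × Fin b) → ι ⊕ κ :=
  Sum.map (fun p => u p.1) fun p => v ((partialProd s t (p.2 + 1))⁻¹ p.1)

theorem card_monodromyFaceLabel_inl (i : ι) :
    Nat.card {e // monodromyFaceLabel s t u v e = .inl i} = Nat.card {x // u x = i} * b := by
  refine Eq.trans ?_ (congrArg (Nat.card {x // u x = i} * ·) (Nat.card_fin b))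
  refine Eq.trans (Nat.card_congr ?_) (Nat.card_prod _ _)
  exact
    { toFun := fun e => match e with
        | ⟨.inl p, h⟩ => (⟨p.1, Sum.inl_injective h⟩, p.2)
        | ⟨.inr p, h⟩ => by simp [monodromyFaceLabel] at h
      invFun := fun p => ⟨.inl (p.1.1, p.2), congrArg Sum.inl p.1.2⟩
      left_inv := by
        rintro ⟨p | p, h⟩
        · rfl
        · simp [monodromyFaceLabel] at h
      right_inv := fun p => rfl }

theorem card_monodromyFaceLabel_inr (j : κ) :
    Nat.card {e // monodromyFaceLabel s t u v e = .inr j} = Nat.card {x // v x = j} * b := by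
  refine Eq.trans ?_ (congrArg (Nat.card {x // v x = j} * ·) (Nat.card_fin b))
  refine Eq.trans (Nat.card_congr ?_) (Nat.card_prod _ _)
  exact
    { toFun := fun e => match e with
        | ⟨.inl p, h⟩ => by simp [monodromyFaceLabel] at h
        | ⟨.inr p, h⟩ => (⟨(partialProd s t (p.2 + 1))⁻¹ p.1, Sum.inr_injective h⟩, p.2)
      invFun := fun p => ⟨.inr (partialProd s t (p.2 + 1) p.1.1, p.2), by
        simp [monodromyFaceLabel, p.1.2]⟩
      left_inv := by
        rintro ⟨p | p, h⟩
        · simp [monodromyFaceLabel] at h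
        · simp
      right_inv := fun p => by simp }

end FaceLabel

end Monodromy

/-! ### The galaxy of a factorisation -/

theorem IsCycleLabelling.surjective {d : ℕ} {σ : Perm (Fin d)} {μ : Composition d}
    {label : Fin d → Fin μ.length} (h : IsCycleLabelling σ μ label) :
    Function.Surjective label := fun i => by
  by_contra hi
  have := h.card_eq i
  have hempty : IsEmpty {x // label x = i} := ⟨fun x => hi ⟨x.1, x.2⟩⟩
  rw [Nat.card_of_isEmpty] at this
  exact absurd (μ.one_le_blocksFun i) (by omega)

theorem simpleCount_add_two {d : ℕ} (hd : 0 < d) (g : ℕ) (μ ν : Composition d) :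
    simpleCount g μ ν + 2 = 2 * g + μ.length + ν.length := by
  have h1 := μ.length_pos_of_pos hd
  have h2 := ν.length_pos_of_pos hd
  unfold simpleCount
  omega

namespace Factorisation

variable {d g : ℕ} {μ ν : Composition d} (f : Factorisation g μ ν)

/-- The type of darts of the galaxy of a factorisation; white darts come first. -/
abbrev GalaxyDart {d : ℕ} (g : ℕ) (μ ν : Composition d) : Type :=
  (Fin d × Fin (simpleCount g μ ν)) ⊕ (Fin d × Fin (simpleCount g μ ν))

/-- The colour and the label of the face on the left of a dart. -/
def dartFaceLabel : GalaxyDart g μ ν → Fin μ.length ⊕ Fin ν.length :=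
  monodromyFaceLabel f.σ₁ f.τ f.label₁ f.label₂

theorem partialProd_eq : partialProd f.σ₁ f.τ (simpleCount g μ ν) = f.σ₂ := by
  rw [partialProd_length, f.prod_eq]

theorem dartFaceLabel_eq_iff (hb : 0 < simpleCount g μ ν) (e e' : GalaxyDart g μ ν) :
    f.dartFaceLabel e = f.dartFaceLabel e' ↔ (monodromyMap f.σ₁ f.τ).next.SameCycle e e' := by
  rcases e with p | p <;> rcases e' with q | q
  · rw [monodromyMap_leftFace_inl _ _ hb, ← f.labelling₁.eq_iff]
    simp [dartFaceLabel, monodromyFaceLabel]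
  · simp [dartFaceLabel, monodromyFaceLabel, monodromyMap_not_sameCycle]
  · rw [Perm.sameCycle_comm]
    simp [dartFaceLabel, monodromyFaceLabel, monodromyMap_not_sameCycle]
  · rw [monodromyMap_leftFace_inr _ _ hb, partialProd_eq, ← f.labelling₂.eq_iff]
    simp [dartFaceLabel, monodromyFaceLabel]

/-- The labelling of the faces. -/
noncomputable def galaxyFaceLabel (hb : 0 < simpleCount g μ ν) :
    (monodromyMap f.σ₁ f.τ).Face ≃ Fin μ.length ⊕ Fin ν.length :=
  Equiv.ofBijective (Quotient.lift f.dartFaceLabel fun e e' h =>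
      (f.dartFaceLabel_eq_iff hb e e').2 h) <| by
    constructor
    · intro a a'
      induction a using Quotient.ind
      induction a' using Quotient.ind
      exact fun h => Quotient.sound ((f.dartFaceLabel_eq_iff hb _ _).1 h)
    · rintro (i | j)
      · obtain ⟨x, rfl⟩ := f.labelling₁.surjective i
        exact ⟨Quotient.mk _ (.inl (x, ⟨0, hb⟩)), rfl⟩
      · obtain ⟨x, rfl⟩ := f.labelling₂.surjective j
        -- The label of a black dart in copy `0` is read after pulling back by `partialProd 1`,
        -- which this witness cancels.
        refine ⟨Quotient.mk _ (.inr (partialProd f.σ₁ f.τ 1 x, ⟨0, hb⟩)), ?_⟩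
        simp [dartFaceLabel, monodromyFaceLabel]

theorem galaxyFaceLabel_leftFace (hb : 0 < simpleCount g μ ν) (e : GalaxyDart g μ ν) :
    f.galaxyFaceLabel hb ((monodromyMap f.σ₁ f.τ).leftFace e) = f.dartFaceLabel e := rfl

theorem galaxyFaceLabel_isLeft (hb : 0 < simpleCount g μ ν) (e : GalaxyDart g μ ν) :
    (f.galaxyFaceLabel hb ((monodromyMap f.σ₁ f.τ).leftFace e)).isLeft = e.isLeft := by
  rw [galaxyFaceLabel_leftFace]
  cases e <;> rfl

theorem boundaryLength_eq (hb : 0 < simpleCount g μ ν) (i : Fin μ.length ⊕ Fin ν.length) :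
    (monodromyMap f.σ₁ f.τ).boundaryLength ((f.galaxyFaceLabel hb).symm i) =
      Nat.card {e // f.dartFaceLabel e = i} :=
  Nat.card_congr (Equiv.subtypeEquivRight fun e => by
    rw [Equiv.eq_symm_apply, galaxyFaceLabel_leftFace])

/-- The Hurwitz galaxy of a factorisation. -/
noncomputable def galaxy (hd : 0 < d) (hb : 0 < simpleCount g μ ν) : HurwitzGalaxy g μ ν where
  Dart := GalaxyDart g μ ν
  finite_dart := inferInstance
  map := monodromyMap f.σ₁ f.τ
  connected := (monodromyMap_isConnected_iff _ hb).2
    ⟨⟨⟨0, hd⟩⟩, by rw [f.prod_eq]; exact f.transitive⟩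
  genus := by
    -- With `V = db - b`, `E = db` and `F = ℓ(μ) + ℓ(ν)`, the Euler characteristic is `ℓ(μ) + ℓ(ν) -
    -- b = 2 - 2g`.
    have h1 := monodromyMap_card_vertex f.σ₁ f.swap
    have h2 := monodromyMap_card_edge f.σ₁ (τ := f.τ)
    have h3 := Nat.card_congr (f.galaxyFaceLabel hb)
    have h4 := simpleCount_add_two hd g μ ν
    simp only [Nat.card_prod, Nat.card_sum, Nat.card_eq_fintype_card (α := Fin _),
      Fintype.card_fin] at h2 h3
    unfold OrientedMap.HasGenus
    omega
  faceLabel := f.galaxyFaceLabel hb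
  colour_rev e := by
    rw [galaxyFaceLabel_isLeft, galaxyFaceLabel_isLeft]
    cases e <;> simp [monodromyMap]
  boundary_white i := by
    rw [boundaryLength_eq, ← f.labelling₁.card_eq i]
    exact card_monodromyFaceLabel_inl ..
  boundary_black j := by
    rw [boundaryLength_eq, ← f.labelling₂.card_eq j]
    exact card_monodromyFaceLabel_inr ..
  vertexLabel := monodromyVertexLabel f.σ₁
  vertexLabel_next e he := by
    rw [galaxyFaceLabel_isLeft] at he
    rcases e with p | p
    · exact monodromyLabel_next _ _ _
    · simp at he
  valency_eq := monodromyMap_valency_eq _ f.swap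
  card_two_valent := monodromyMap_card_two_valent _ f.swap
  card_four_valent := monodromyMap_card_four_valent _ f.swap

end Factorisation

/-! ### Transport of cycles and connectedness between maps -/

theorem Equiv.apply_zpow_of_semiconj {α β : Type} {f : Perm α} {g : Perm β} {F : α → β}
    (h : ∀ x, F (f x) = g (F x)) (i : ℤ) (x : α) : F ((f ^ i) x) = (g ^ i) (F x) := by
  induction i using Int.induction_on with
  | zero => rfl
  | succ i ih => rw [add_comm, zpow_add, zpow_add, zpow_one, zpow_one, Perm.mul_apply, h, ih,
      Perm.mul_apply]
  | pred i ih =>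
    have h1 : ∀ {γ : Type} (k : Perm γ), k ^ (-(i : ℤ)) = k * k ^ (-(i : ℤ) - 1) := fun k => by
      rw [← zpow_one_add]
      congr 1
      ring
    rw [h1, h1, Perm.mul_apply, Perm.mul_apply, h] at ih
    exact g.injective ih

theorem Equiv.Perm.sameCycle_iff_of_semiconj {α β : Type} {f : Perm α} {g : Perm β} {F : α → β}
    (hF : Function.Injective F) (h : ∀ x, F (f x) = g (F x)) {x y : α} :
    g.SameCycle (F x) (F y) ↔ f.SameCycle x y := by
  simp only [Perm.SameCycle, ← apply_zpow_of_semiconj h, hF.eq_iff]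

theorem OrientedMap.map_next {D D' : Type} {M : OrientedMap D} {M' : OrientedMap D'} {F : D → D'}
    (hrot : ∀ e, F (M.rot e) = M'.rot (F e)) (hrev : ∀ e, F (M.rev e) = M'.rev (F e)) (e : D) :
    F (M.next e) = M'.next (F e) := by
  apply M'.rot.injective
  rw [← hrot, rot_next, rot_next, hrev]

theorem OrientedMap.IsConnected.of_equiv {D D' : Type} {M : OrientedMap D} {M' : OrientedMap D'}
    (F : D ≃ D') (hrot : ∀ e, F (M.rot e) = M'.rot (F e))
    (hrev : ∀ e, F (M.rev e) = M'.rev (F e)) (h : M'.IsConnected) : M.IsConnected := by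
  rw [isConnected_iff] at h ⊢
  refine ⟨h.1.map F.symm, fun r hr hr' e e' => ?_⟩
  have := h.2 (r.comap F.symm) ?_ ?_ (F e) (F e')
  · change r (F.symm (F e)) (F.symm (F e')) at this
    rwa [F.symm_apply_apply, F.symm_apply_apply] at this
  · intro e
    obtain ⟨e, rfl⟩ := F.surjective e
    rw [← hrot]
    change r (F.symm (F _)) (F.symm (F _))
    rw [F.symm_apply_apply, F.symm_apply_apply]
    exact hr e
  · intro e
    obtain ⟨e, rfl⟩ := F.surjective e
    rw [← hrev]
    change r (F.symm (F _)) (F.symm (F _))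
    rw [F.symm_apply_apply, F.symm_apply_apply]
    exact hr' e

/-! ### The base of a galaxy and its monodromy -/

namespace HurwitzGalaxy

variable {d g : ℕ} {μ ν : Composition d} (G : HurwitzGalaxy g μ ν)

instance : Finite G.Dart := G.finite_dart

/-- Whether the face on the left of a dart is white. -/
def white (e : G.Dart) : Bool := (G.faceLabel (G.map.leftFace e)).isLeft

/-- The label of the origin of a dart. -/
def label (e : G.Dart) : Fin (simpleCount g μ ν) := G.vertexLabel (G.map.origin e)

@[simp] theorem white_rev (e : G.Dart) : G.white (G.map.rev e) = !G.white e := by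
  have := G.colour_rev e
  change G.white _ ≠ G.white _ at this
  simpa using Bool.eq_not_of_ne this

@[simp] theorem white_next (e : G.Dart) : G.white (G.map.next e) = G.white e := by
  simp [white]

@[simp] theorem white_rot (e : G.Dart) : G.white (G.map.rot e) = !G.white e := by
  obtain ⟨e, rfl⟩ := G.map.next.surjective e
  rw [OrientedMap.rot_next, white_rev, white_next]

@[simp] theorem label_rot (e : G.Dart) : G.label (G.map.rot e) = G.label e := by
  simp [label]

theorem label_next {e : G.Dart} (he : G.white e = true) :
    G.label (G.map.next e) = finRotate _ (G.label e) := G.vertexLabel_next e he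

theorem rev_rev (e : G.Dart) : G.map.rev (G.map.rev e) = e := G.map.rev_rev e

theorem simpleCount_pos (G : HurwitzGalaxy g μ ν) : 0 < simpleCount g μ ν :=
  let ⟨e⟩ := G.connected.1
  (G.label e).pos

theorem rot_rot_eq_iff (e : G.Dart) :
    G.map.rot (G.map.rot e) = e ↔ G.map.valency (G.map.origin e) ≠ 4 := by
  rw [OrientedMap.valency_origin]
  constructor
  · intro h h4
    have : Function.minimalPeriod G.map.rot e ∣ 2 := Function.IsPeriodicPt.minimalPeriod_dvd h
    rw [h4] at this
    omega
  · intro h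
    have h2 : Function.minimalPeriod G.map.rot e = 2 := by
      have := G.valency_eq (G.map.origin e)
      rw [OrientedMap.valency_origin] at this
      exact this.resolve_right h
    have := Function.isPeriodicPt_minimalPeriod G.map.rot e
    rwa [h2] at this

theorem rot_rot_rot_rot (e : G.Dart) :
    G.map.rot (G.map.rot (G.map.rot (G.map.rot e))) = e := by
  have h : Function.minimalPeriod G.map.rot e ∣ 4 := by
    rcases G.valency_eq (G.map.origin e) with h | h <;> rw [OrientedMap.valency_origin] at h <;>
      rw [h]
    exact ⟨2, rfl⟩
  exact (Function.isPeriodicPt_minimalPeriod G.map.rot e).trans_dvd h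

theorem exists_four_valent (k : Fin (simpleCount g μ ν)) : ∃ e : G.Dart,
    G.white e = true ∧ G.label e = k ∧ G.map.rot (G.map.rot e) ≠ e := by
  obtain ⟨⟨v, hv, hv'⟩, -⟩ := Nat.card_eq_one_iff_exists.1 (G.card_four_valent k)
  obtain ⟨e, rfl⟩ := Quotient.exists_rep v
  have key : ∀ e, G.map.valency (G.map.origin e) = 4 → G.map.rot (G.map.rot e) ≠ e :=
    fun e h h' => (G.rot_rot_eq_iff e).1 h' h
  cases h : G.white e
  · exact ⟨G.map.rot e, by simp [h], by rw [label_rot]; exact hv,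
      key _ (by rw [OrientedMap.origin_rot]; exact hv')⟩
  · exact ⟨e, h, hv, key _ hv'⟩

theorem origin_eq_of_four_valent {e e' : G.Dart} (h : G.map.rot (G.map.rot e) ≠ e)
    (h' : G.map.rot (G.map.rot e') ≠ e') (hl : G.label e = G.label e') :
    G.map.origin e = G.map.origin e' := by
  have := Nat.card_eq_one_iff_exists.1 (G.card_four_valent (G.label e'))
  obtain ⟨v, hv⟩ := this
  rw [ne_eq, G.rot_rot_eq_iff, not_not] at h h'
  have h1 := hv ⟨_, hl, h⟩
  have h2 := hv ⟨_, rfl, h'⟩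
  exact congrArg Subtype.val (h1.trans h2.symm)

@[simp] theorem white_next_zpow (e : G.Dart) (i : ℤ) :
    G.white ((G.map.next ^ i) e) = G.white e :=
  Perm.SameCycle.apply_eq_of_invariant G.white_next (Perm.SameCycle.symm ⟨i, rfl⟩)

theorem label_next_pow {e : G.Dart} (he : G.white e = true) (j : ℕ)
    (hj : (G.label e : ℕ) + j < simpleCount g μ ν) :
    (G.label ((G.map.next ^ j) e) : ℕ) = G.label e + j := by
  induction j with
  | zero => rfl
  | succ j ih =>
    have hw := G.white_next_zpow e j
    rw [zpow_natCast] at hw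
    rw [pow_succ', Perm.mul_apply, G.label_next (hw.trans he), val_finRotate, ih (by omega),
      if_pos (by omega)]
    omega

theorem label_next_zpow_neg {e : G.Dart} (he : G.white e = true) (j : ℕ)
    (hj : j ≤ (G.label e : ℕ)) :
    (G.label ((G.map.next ^ (-(j : ℤ))) e) : ℕ) + j = G.label e := by
  induction j with
  | zero => rfl
  | succ j ih =>
    specialize ih (by omega)
    have h1 : G.map.next ((G.map.next ^ (-((j + 1 : ℕ) : ℤ))) e) =
        (G.map.next ^ (-(j : ℤ))) e := by
      rw [← Perm.mul_apply, ← zpow_one_add]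
      congr 2
      push_cast
      ring
    rw [← h1, G.label_next ((G.white_next_zpow _ _).trans he), val_finRotate] at ih
    split_ifs at ih <;> omega

/-- A white dart whose origin has the last label. -/
def IsBase (e : G.Dart) : Prop := G.white e = true ∧ (G.label e : ℕ) + 1 = simpleCount g μ ν

/-- The white darts whose origin has the last label. -/
abbrev Base : Type := {e : G.Dart // G.IsBase e}

/-- The darts in terms of those in the base. -/
def dartOfBase :
    (G.Base × Fin (simpleCount g μ ν)) ⊕ (G.Base × Fin (simpleCount g μ ν)) → G.Dart :=
  let F : G.Base × Fin (simpleCount g μ ν) → G.Dart := fun p =>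
    -- Base darts have label `b - 1`, so label `k` is found `b - 1 - k` steps earlier, without
    -- crossing the wrap.
    (G.map.next ^ (-((simpleCount g μ ν - 1 - p.2 : ℕ) : ℤ))) p.1.1
  Sum.elim F (fun p => G.map.rev (F p))

theorem dartOfBase_inl (x : G.Base) (k : Fin (simpleCount g μ ν)) : G.dartOfBase (.inl (x, k)) =
    (G.map.next ^ (-((simpleCount g μ ν - 1 - k : ℕ) : ℤ))) x.1 := rfl

theorem dartOfBase_inr (p : G.Base × Fin (simpleCount g μ ν)) :
    G.dartOfBase (.inr p) = G.map.rev (G.dartOfBase (.inl p)) := rfl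

theorem white_dartOfBase_inl (p : G.Base × Fin (simpleCount g μ ν)) :
    G.white (G.dartOfBase (.inl p)) = true :=
  (G.white_next_zpow _ _).trans p.1.2.1

theorem white_dartOfBase_inr (p : G.Base × Fin (simpleCount g μ ν)) :
    G.white (G.dartOfBase (.inr p)) = false := by
  rw [dartOfBase_inr, white_rev, white_dartOfBase_inl, Bool.not_true]

theorem label_dartOfBase_inl (p : G.Base × Fin (simpleCount g μ ν)) :
    G.label (G.dartOfBase (.inl p)) = p.2 := by
  have h1 := p.1.2.2
  have h2 := G.label_next_zpow_neg p.1.2.1 (simpleCount g μ ν - 1 - p.2) (by omega)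
  have h3 := p.2.isLt
  apply Fin.ext
  change (G.label ((G.map.next ^ (-((simpleCount g μ ν - 1 - p.2 : ℕ) : ℤ))) p.1.1) : ℕ) = _
  omega

/-- A white dart with label `k` reaches exactly one base dart after `b - 1 - k` steps, and reversal
exchanges white and black darts. -/
theorem dartOfBase_bijective : Function.Bijective G.dartOfBase := by
  have hinj : ∀ p q, G.dartOfBase (.inl p) = G.dartOfBase (.inl q) → p = q := fun p q h => by
    have hk := G.label_dartOfBase_inl p
    rw [h, label_dartOfBase_inl] at hk
    obtain ⟨x, k⟩ := p
    obtain ⟨y, l⟩ := q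
    obtain rfl : l = k := hk
    rw [dartOfBase_inl, dartOfBase_inl, EmbeddingLike.apply_eq_iff_eq] at h
    rw [Subtype.ext h]
  have hsurj : ∀ e, G.white e = true → ∃ p, G.dartOfBase (.inl p) = e := fun e he => by
    have hlt := (G.label e).isLt
    refine ⟨(⟨(G.map.next ^ ((simpleCount g μ ν - 1 - G.label e : ℕ) : ℤ)) e,
      (G.white_next_zpow _ _).trans he, ?_⟩, G.label e), ?_⟩
    · rw [zpow_natCast, G.label_next_pow he _ (by omega)]
      omega
    · rw [dartOfBase_inl, ← Perm.mul_apply, ← zpow_add, neg_add_cancel, zpow_zero, Perm.one_apply]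
  constructor
  · rintro (p | p) (q | q) h
    · rw [hinj p q h]
    · have := congrArg G.white h
      simp [white_dartOfBase_inl, white_dartOfBase_inr] at this
    · have := congrArg G.white h
      simp [white_dartOfBase_inl, white_dartOfBase_inr] at this
    · rw [hinj p q (G.map.rev.injective h)]
  · intro e
    cases h : G.white e
    · obtain ⟨p, hp⟩ := hsurj (G.map.rev e) (by simp [h])
      exact ⟨.inr p, by rw [dartOfBase_inr, hp, rev_rev]⟩
    · obtain ⟨p, hp⟩ := hsurj e h
      exact ⟨_, hp⟩

theorem card_base : Nat.card G.Base = d := by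
  have h := Nat.card_congr (Equiv.ofBijective _ G.dartOfBase_bijective)
  rw [G.card_dart, Nat.card_sum, Nat.card_prod, Nat.card_fin] at h
  exact Nat.eq_of_mul_eq_mul_right G.simpleCount_pos (by omega)

/-- The monodromy around the white faces. -/
noncomputable def baseWhite : Perm G.Base :=
  Perm.subtypePermOfFintype (G.map.next ^ simpleCount g μ ν) (p := G.IsBase) fun e he => by
    have hb := G.simpleCount_pos
    have h0 : (G.label (G.map.next e) : ℕ) = 0 := by
      rw [G.label_next he.1, val_finRotate, if_neg (by have := he.2; omega)]
    -- The first of the `b` steps wraps to label `0`; the other `b - 1` climb back to the last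
    -- label.
    have h1 : G.map.next ^ simpleCount g μ ν =
        G.map.next ^ (simpleCount g μ ν - 1) * G.map.next := by
      rw [← pow_succ, Nat.sub_add_cancel hb]
    constructor
    · rw [← zpow_natCast, white_next_zpow, he.1]
    · rw [h1, Perm.mul_apply, G.label_next_pow (by rw [white_next, he.1]) _ (by omega)]
      omega

theorem val_baseWhite (x : G.Base) :
    (G.baseWhite x).1 = (G.map.next ^ (simpleCount g μ ν : ℤ)) x.1 := rfl

/-- Two turns preserve the colour and the label, so they act within the white darts with label `k`.
-/
theorem exists_baseSwap (k : Fin (simpleCount g μ ν)) (x : G.Base) :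
    ∃ y, G.dartOfBase (.inl (y, k)) = G.map.rot (G.map.rot (G.dartOfBase (.inl (x, k)))) := by
  obtain ⟨⟨y, l⟩ | p, h⟩ := G.dartOfBase_bijective.2
    (G.map.rot (G.map.rot (G.dartOfBase (.inl (x, k)))))
  · have := congrArg G.label h
    rw [label_rot, label_rot, label_dartOfBase_inl, label_dartOfBase_inl] at this
    obtain rfl : l = k := this
    exact ⟨y, h⟩
  · have := congrArg G.white h
    simp [white_dartOfBase_inl, white_dartOfBase_inr] at this

/-- The monodromy at the four-valent vertex with label `k`. -/
noncomputable def baseSwap (k : Fin (simpleCount g μ ν)) : Perm G.Base :=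
  Function.Involutive.toPerm (fun x => (G.exists_baseSwap k x).choose) fun x => by
    have h1 := (G.exists_baseSwap k x).choose_spec
    have h2 := (G.exists_baseSwap k (G.exists_baseSwap k x).choose).choose_spec
    have h3 := h2.trans (congrArg (fun e => G.map.rot (G.map.rot e)) h1)
    rw [rot_rot_rot_rot] at h3
    simpa using G.dartOfBase_bijective.1 h3

theorem dartOfBase_baseSwap (k : Fin (simpleCount g μ ν)) (x : G.Base) :
    G.dartOfBase (.inl (G.baseSwap k x, k)) =
      G.map.rot (G.map.rot (G.dartOfBase (.inl (x, k)))) :=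
  (G.exists_baseSwap k x).choose_spec

/-- Steps below the last label stay in the same sheet. A step out of the base enters the block that
ends at the next base dart, `next ^ b` further on, which is why `baseWhite` sits at the step into
copy `0`. -/
theorem dartOfBase_towerPerm (p : G.Base × Fin (simpleCount g μ ν)) :
    G.dartOfBase (.inl (towerPerm (firstStep G.baseWhite) p)) =
      G.map.next (G.dartOfBase (.inl p)) := by
  obtain ⟨x, k⟩ := p
  have hk := k.isLt
  rw [towerPerm_apply, dartOfBase_inl, dartOfBase_inl, ← Perm.mul_apply, ← zpow_one_add]
  have hrot := val_finRotate k
  split_ifs at hrot with h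
  · rw [firstStep, if_neg (by omega), hrot, Perm.one_apply]
    congr 2
    omega
  · rw [firstStep, if_pos hrot, val_baseWhite, ← Perm.mul_apply, ← zpow_add]
    congr 2
    omega

theorem dartOfBase_rev (e) : G.dartOfBase ((monodromyMap G.baseWhite G.baseSwap).rev e) =
    G.map.rev (G.dartOfBase e) := by
  rcases e with p | p
  · rfl
  · rw [dartOfBase_inr, rev_rev]
    rfl

end HurwitzGalaxy

/-! ### The factorisation of a galaxy with numbered base -/

theorem permCongr_towerPerm {X Y : Type} {b : ℕ} (β : X ≃ Y) (c : Fin b → Perm Y)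
    (p : X × Fin b) : (towerPerm fun k => β.symm.permCongr (c k)) p =
      (β.symm (towerPerm c (β p.1, p.2)).1, (towerPerm c (β p.1, p.2)).2) := rfl

theorem permCongr_firstStep {X Y : Type} {b : ℕ} (β : X ≃ Y) (σ : Perm Y) (k : Fin b) :
    firstStep (β.symm.permCongr σ) k = β.symm.permCongr (firstStep σ k) := by
  unfold firstStep
  split_ifs
  · rfl
  · ext; simp

namespace HurwitzGalaxy

variable {d g : ℕ} {μ ν : Composition d} (G : HurwitzGalaxy g μ ν) (β : Fin d ≃ G.Base)

/-- The monodromy around the white faces, for a numbering of the base. -/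
noncomputable def markedWhite : Perm (Fin d) := β.symm.permCongr G.baseWhite

/-- The monodromy at the four-valent vertices, for a numbering of the base. -/
noncomputable def markedSwap (k : Fin (simpleCount g μ ν)) : Perm (Fin d) :=
  β.symm.permCongr (G.baseSwap k)

/-- The darts in terms of a numbering of the base. -/
noncomputable def markedDart : Factorisation.GalaxyDart g μ ν ≃ G.Dart :=
  (Equiv.sumCongr (β.prodCongr (Equiv.refl _)) (β.prodCongr (Equiv.refl _))).trans
    (Equiv.ofBijective _ G.dartOfBase_bijective)

theorem markedDart_inl (x : Fin d) (k : Fin (simpleCount g μ ν)) :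
    G.markedDart β (.inl (x, k)) = G.dartOfBase (.inl (β x, k)) := rfl

theorem markedDart_inr (x : Fin d) (k : Fin (simpleCount g μ ν)) :
    G.markedDart β (.inr (x, k)) = G.dartOfBase (.inr (β x, k)) := rfl

/-- The map of the monodromy of a galaxy. -/
noncomputable abbrev markedMap : OrientedMap (Factorisation.GalaxyDart g μ ν) :=
  monodromyMap (G.markedWhite β) (G.markedSwap β)

theorem markedDart_rev (e) :
    G.markedDart β ((G.markedMap β).rev e) = G.map.rev (G.markedDart β e) := by
  rcases e with ⟨x, k⟩ | ⟨x, k⟩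
  · exact G.dartOfBase_rev (.inl (β x, k))
  · exact G.dartOfBase_rev (.inr (β x, k))

theorem markedDart_rot (e) :
    G.markedDart β ((G.markedMap β).rot e) = G.map.rot (G.markedDart β e) := by
  -- This is `rot ∘ next = rev` on white darts. It gives `rot` of a white dart directly; a black
  -- dart is then `rot` of a white one, so its own `rot` is two turns, that is `baseSwap`.
  have key : ∀ p, G.map.rev (G.markedDart β (.inl p)) =
      G.map.rot (G.markedDart β (.inl (towerPerm (firstStep (G.markedWhite β)) p))) := fun p => by
    have : firstStep (b := simpleCount g μ ν) (G.markedWhite β) =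
        fun k => β.symm.permCongr (firstStep G.baseWhite k) :=
      funext fun k => permCongr_firstStep ..
    rw [this, permCongr_towerPerm, markedDart_inl, markedDart_inl, apply_symm_apply,
      dartOfBase_towerPerm, OrientedMap.rot_next]
  rcases e with p | p
  · obtain ⟨p, rfl⟩ := (towerPerm (firstStep (G.markedWhite β))).surjective p
    rw [← key, markedMap, monodromyMap, OrientedMap.ofFaces_rot_inl, ← Perm.mul_apply,
      inv_mul_cancel]
    rfl
  · have h1 := key p
    rw [← markedDart_rev] at h1
    change G.markedDart β (.inr p) = _ at h1
    rw [h1, markedDart_inl, ← dartOfBase_baseSwap, markedMap, monodromyMap,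
      OrientedMap.ofFaces_rot_inr, towerPerm_apply, markedDart_inl, Perm.mul_apply]
    conv_lhs => rw [markedSwap, permCongr_apply, apply_symm_apply]
    rfl

theorem markedDart_next (e) :
    G.markedDart β ((G.markedMap β).next e) = G.map.next (G.markedDart β e) :=
  OrientedMap.map_next (G.markedDart_rot β) (G.markedDart_rev β) e

theorem markedDart_leftFace_eq_iff (e e') :
    G.map.leftFace (G.markedDart β e) = G.map.leftFace (G.markedDart β e') ↔
      (G.markedMap β).next.SameCycle e e' := by
  rw [OrientedMap.leftFace_eq_iff]
  exact Perm.sameCycle_iff_of_semiconj (G.markedDart β).injective (G.markedDart_next β)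

theorem markedDart_origin_eq_iff (e e') :
    G.map.origin (G.markedDart β e) = G.map.origin (G.markedDart β e') ↔
      (G.markedMap β).origin e = (G.markedMap β).origin e' := by
  rw [OrientedMap.origin_eq_iff, OrientedMap.origin_eq_iff]
  exact Perm.sameCycle_iff_of_semiconj (G.markedDart β).injective (G.markedDart_rot β)

theorem markedSwap_apply_apply (k x) : G.markedSwap β k (G.markedSwap β k x) = x := by
  apply Sum.inl_injective.comp (Prod.mk_left_injective k)
  apply (G.markedDart β).injective
  dsimp only [Function.comp_apply]
  rw [← monodromyMap_rot_rot (G.markedWhite β), ← monodromyMap_rot_rot (G.markedWhite β),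
    markedDart_rot, markedDart_rot, markedDart_rot, markedDart_rot, rot_rot_rot_rot]

theorem markedSwap_apply_eq_iff (k x) : G.markedSwap β k x = x ↔
    G.map.rot (G.map.rot (G.markedDart β (.inl (x, k)))) = G.markedDart β (.inl (x, k)) := by
  rw [← markedDart_rot, ← markedDart_rot, monodromyMap_rot_rot]
  simp

theorem label_markedDart (e) : G.label (G.markedDart β e) = monodromyLabel e := by
  have h1 : ∀ p, G.label (G.markedDart β (.inl p)) = p.2 := fun p => G.label_dartOfBase_inl _
  rcases e with p | p
  · exact h1 p
  · rw [← label_rot, ← markedDart_rot]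
    exact h1 _

/-- Points moved by `markedSwap β k` are white darts at four-valent vertices with label `k`. There
is only one such vertex, and its white darts form a single orbit `{x, τ x}`. -/
theorem markedSwap_isSwap (k) : (G.markedSwap β k).IsSwap := by
  obtain ⟨e, he, hl, hrot⟩ := G.exists_four_valent k
  obtain ⟨⟨x, l⟩ | p, rfl⟩ := (G.markedDart β).surjective e
  · rw [label_markedDart] at hl
    obtain rfl : l = k := hl
    rw [ne_eq, ← markedSwap_apply_eq_iff] at hrot
    refine ⟨x, G.markedSwap β l x, Ne.symm hrot, Equiv.ext fun y => ?_⟩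
    have hx : ∀ y, G.markedSwap β l y ≠ y → y = x ∨ y = G.markedSwap β l x := fun y hy => by
      have := G.origin_eq_of_four_valent
        (mt (G.markedSwap_apply_eq_iff β l x).2 hrot) (mt (G.markedSwap_apply_eq_iff β l y).2 hy)
        (by rw [label_markedDart, label_markedDart]; rfl)
      rw [markedDart_origin_eq_iff,
        monodromyMap_origin_inl _ (G.markedSwap_apply_apply β)] at this
      exact this.2
    by_cases h1 : y = x
    · rw [h1, swap_apply_left]
    by_cases h2 : y = G.markedSwap β l x
    · rw [h2, swap_apply_right, markedSwap_apply_apply]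
    rw [swap_apply_of_ne_of_ne h1 h2]
    by_contra h3
    exact (hx y h3).elim h1 h2
  · have := G.white_dartOfBase_inr (β p.1, p.2)
    rw [← markedDart_inr] at this
    simp [he] at this

/-- The number of the last label. -/
def lastLabel (G : HurwitzGalaxy g μ ν) : Fin (simpleCount g μ ν) :=
  ⟨simpleCount g μ ν - 1, Nat.sub_lt G.simpleCount_pos Nat.one_pos⟩

/-- The monodromy around the black faces. -/
noncomputable def markedBlack : Perm (Fin d) :=
  partialProd (G.markedWhite β) (G.markedSwap β) (simpleCount g μ ν)

theorem white_markedDart (e) : G.white (G.markedDart β e) = e.isLeft := by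
  rcases e with p | p
  · exact G.white_dartOfBase_inl _
  · exact G.white_dartOfBase_inr _

/-- The labelling of the cycles of the monodromy around the white faces. -/
noncomputable def markedLabelWhite (x : Fin d) : Fin μ.length :=
  (G.faceLabel (G.map.leftFace (G.markedDart β (.inl (x, G.lastLabel))))).getLeft
    (G.white_markedDart β _)

/-- The labelling of the cycles of the monodromy around the black faces. -/
noncomputable def markedLabelBlack (x : Fin d) : Fin ν.length :=
  (G.faceLabel (G.map.leftFace
    -- In the last copy black labels are read after pulling back by the full product `markedBlack`;
    -- applying it to `x` first compensates.
    (G.markedDart β (.inr (G.markedBlack β x, G.lastLabel))))).getRight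
    (by have := G.white_markedDart β (.inr (G.markedBlack β x, G.lastLabel))
        rw [← Sum.not_isLeft]; unfold white at this; rw [this]; simp)

theorem faceLabel_markedDart (e) : G.faceLabel (G.map.leftFace (G.markedDart β e)) =
    monodromyFaceLabel (G.markedWhite β) (G.markedSwap β) (G.markedLabelWhite β)
      (G.markedLabelBlack β) e := by
  rcases e with ⟨x, k⟩ | ⟨x, k⟩
  · refine Eq.trans (congrArg _ ?_) (Sum.inl_getLeft _ _).symm
    rw [markedDart_leftFace_eq_iff, monodromyMap_leftFace_inl _ _ G.simpleCount_pos]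
  · refine Eq.trans (congrArg _ ?_) (Sum.inr_getRight _ _).symm
    rw [markedDart_leftFace_eq_iff, monodromyMap_leftFace_inr _ _ G.simpleCount_pos]
    simp only [lastLabel, Nat.sub_add_cancel G.simpleCount_pos, markedBlack]
    simp [Perm.SameCycle.refl]

theorem boundaryLength_marked (i) : G.map.boundaryLength (G.faceLabel.symm i) =
    Nat.card {e // monodromyFaceLabel (G.markedWhite β) (G.markedSwap β) (G.markedLabelWhite β)
      (G.markedLabelBlack β) e = i} := by
  refine (Nat.card_congr ((G.markedDart β).subtypeEquiv fun e => ?_)).symm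
  rw [← faceLabel_markedDart, Equiv.eq_symm_apply]

/-- White faces are the cycles, each point contributing `b` darts, so cancelling `b` in the boundary
length gives the cycle length. -/
theorem markedLabelWhite_isCycleLabelling :
    IsCycleLabelling (G.markedWhite β) μ (G.markedLabelWhite β) where
  eq_iff x y := by
    rw [← monodromyMap_leftFace_inl _ (G.markedSwap β) G.simpleCount_pos (x, G.lastLabel)
      (y, G.lastLabel), ← markedDart_leftFace_eq_iff, ← EmbeddingLike.apply_eq_iff_eq G.faceLabel,
      faceLabel_markedDart, faceLabel_markedDart]
    simp [monodromyFaceLabel]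
  card_eq i := by
    have := G.boundary_white i
    rw [G.boundaryLength_marked β, card_monodromyFaceLabel_inl] at this
    exact Nat.eq_of_mul_eq_mul_right G.simpleCount_pos this

theorem markedLabelBlack_isCycleLabelling :
    IsCycleLabelling (G.markedBlack β) ν (G.markedLabelBlack β) where
  eq_iff x y := by
    have h := G.markedDart_leftFace_eq_iff β (.inr (G.markedBlack β x, G.lastLabel))
      (.inr (G.markedBlack β y, G.lastLabel))
    rw [monodromyMap_leftFace_inr _ _ G.simpleCount_pos,
      ← EmbeddingLike.apply_eq_iff_eq G.faceLabel,
      faceLabel_markedDart, faceLabel_markedDart] at h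
    simpa [monodromyFaceLabel, lastLabel, Nat.sub_add_cancel G.simpleCount_pos, markedBlack]
      using h
  card_eq i := by
    have := G.boundary_black i
    rw [G.boundaryLength_marked β, card_monodromyFaceLabel_inr] at this
    exact Nat.eq_of_mul_eq_mul_right G.simpleCount_pos this

/-- The factorisation that belongs to a galaxy with a numbering of its base. -/
noncomputable def factorisation : Factorisation g μ ν where
  σ₁ := G.markedWhite β
  τ := G.markedSwap β
  σ₂ := G.markedBlack β
  label₁ := G.markedLabelWhite β
  label₂ := G.markedLabelBlack β
  labelling₁ := G.markedLabelWhite_isCycleLabelling β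
  labelling₂ := G.markedLabelBlack_isCycleLabelling β
  swap := G.markedSwap_isSwap β
  transitive := by
    rw [markedBlack, partialProd_length]
    exact ((monodromyMap_isConnected_iff _ G.simpleCount_pos).1
      (G.connected.of_equiv (G.markedDart β) (G.markedDart_rot β) (G.markedDart_rev β))).2
  prod_eq := (partialProd_length _ _).symm

/-- A galaxy is isomorphic to the galaxy of its factorisation. -/
noncomputable def factorisationIso (hd : 0 < d) (hb : 0 < simpleCount g μ ν) :
    Iso ((G.factorisation β).galaxy hd hb) G where
  toEquiv := G.markedDart β
  map_rot := G.markedDart_rot β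
  map_rev := G.markedDart_rev β
  map_faceLabel := G.faceLabel_markedDart β
  map_vertexLabel := G.label_markedDart β

end HurwitzGalaxy

/-! ### Bi-pruned galaxies and bi-pruned factorisations -/

namespace HurwitzGalaxy

variable {d g : ℕ} {μ ν : Composition d}

/-- The four-valent vertex with label `j` lies on the boundary of the face with label `i`. -/
def Meets (G : HurwitzGalaxy g μ ν) (i : Fin μ.length ⊕ Fin ν.length)
    (j : Fin (simpleCount g μ ν)) : Prop :=
  ∃ e, G.faceLabel (G.map.leftFace e) = i ∧ G.map.rot (G.map.rot e) ≠ e ∧ G.label e = j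

/-- Four-valent vertices correspond one to one to labels, so two distinct ones on a face amount to
two distinct labels. -/
theorem isBiPruned_iff (G : HurwitzGalaxy g μ ν) :
    G.IsBiPruned ↔ ∀ i, ∃ j k, j ≠ k ∧ G.Meets i j ∧ G.Meets i k := by
  have key : ∀ e, G.map.valency (G.map.origin e) = 4 ↔ G.map.rot (G.map.rot e) ≠ e := fun e => by
    rw [ne_eq, rot_rot_eq_iff, not_not]
  unfold IsBiPruned
  rw [← G.faceLabel.symm.forall_congr_right]
  refine forall_congr' fun i => ?_
  rw [IsLoopFace, Set.not_subsingleton_iff]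
  constructor
  · rintro ⟨_, ⟨h, e, rfl, he⟩, _, ⟨h', e', rfl, he'⟩, hne⟩
    rw [key] at h h'
    rw [Equiv.eq_symm_apply] at he he'
    exact ⟨_, _, fun hl => hne (G.origin_eq_of_four_valent h h' hl), ⟨e, he, h, rfl⟩,
      ⟨e', he', h', rfl⟩⟩
  · rintro ⟨_, _, hne, ⟨e, he, h, rfl⟩, ⟨e', he', h', rfl⟩⟩
    exact ⟨_, ⟨(key e).2 h, e, rfl, (Equiv.eq_symm_apply _).2 he⟩, _,
      ⟨(key e').2 h', e', rfl, (Equiv.eq_symm_apply _).2 he'⟩,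
      fun h => hne (congrArg G.vertexLabel h)⟩

theorem IsBiPruned.of_iso {G H : HurwitzGalaxy g μ ν} (φ : Iso G H) (h : G.IsBiPruned) :
    H.IsBiPruned := by
  have key : ∀ i j, G.Meets i j → H.Meets i j := by
    rintro i j ⟨e, rfl, he, rfl⟩
    refine ⟨φ.toEquiv e, φ.map_faceLabel e, ?_, φ.map_vertexLabel e⟩
    rw [← φ.map_rot, ← φ.map_rot]
    exact φ.toEquiv.injective.ne he
  rw [isBiPruned_iff] at h ⊢
  exact fun i => let ⟨j, k, hne, hj, hk⟩ := h i
    ⟨j, k, hne, key _ _ hj, key _ _ hk⟩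

end HurwitzGalaxy

namespace Factorisation

variable {d g : ℕ} {μ ν : Composition d} (f : Factorisation g μ ν)
  (hd : 0 < d) (hb : 0 < simpleCount g μ ν)

theorem meets_inl_iff (i : Fin μ.length) (j : Fin (simpleCount g μ ν)) :
    (f.galaxy hd hb).Meets (.inl i) j ↔ ({x | f.τ j x ≠ x} ∩ {x | f.label₁ x = i}).Nonempty := by
  have key : ∀ x k, (f.galaxy hd hb).map.rot ((f.galaxy hd hb).map.rot (.inl (x, k))) =
      Sum.inl (f.τ k x, k) := monodromyMap_rot_rot _ _
  constructor
  · rintro ⟨⟨x, k⟩ | p, hi, he, hj⟩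
    · obtain rfl : k = j := hj
      rw [key] at he
      exact ⟨x, fun h => he (by rw [h]), Sum.inl_injective hi⟩
    · exact absurd (congrArg Sum.isLeft hi) Bool.false_ne_true
  · rintro ⟨x, hx, rfl⟩
    refine ⟨.inl (x, j), rfl, ?_, rfl⟩
    rw [key]
    exact fun h => hx (congrArg Prod.fst (Sum.inl_injective h))

/-- `π_j` is the conjugate of `τ_j` by the partial product just before it. -/
theorem inv_apply_ne_iff (j : Fin (simpleCount g μ ν)) (x : Fin d) :
    f.inv j ((partialProd f.σ₁ f.τ j)⁻¹ x) ≠ (partialProd f.σ₁ f.τ j)⁻¹ x ↔ f.τ j x ≠ x := by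
  rw [inv, partialProd_succ]
  simp

/-- Expresses the black label through the partial product just before the transposition at the
origin of the dart, the one that conjugates `τ` to `π`. At the wrap the two readings differ by one
application of `σ₂`, which stays in the same cycle. -/
theorem dartFaceLabel_inr (x : Fin d) (k : Fin (simpleCount g μ ν)) :
    f.dartFaceLabel (.inr (x, k)) = .inr (f.label₂
      ((partialProd f.σ₁ f.τ (finRotate _ k))⁻¹ (firstStep f.σ₁ (finRotate _ k) x))) := by
  refine congrArg Sum.inr ?_
  have hk := k.isLt
  have hrot := val_finRotate k
  split_ifs at hrot with h
  · rw [firstStep, if_neg (by omega), hrot]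
    rfl
  · have h1 : (k : ℕ) + 1 = simpleCount g μ ν := by omega
    rw [firstStep, if_pos hrot, hrot, partialProd_zero]
    dsimp only
    rw [h1, partialProd_eq, f.labelling₂.eq_iff]
    exact ⟨1, by simp⟩

theorem meets_inr_iff (i : Fin ν.length) (j : Fin (simpleCount g μ ν)) :
    (f.galaxy hd hb).Meets (.inr i) j ↔
      ({x | f.inv j x ≠ x} ∩ {x | f.label₂ x = i}).Nonempty := by
  have key : ∀ (x : Fin d) k,
      (f.galaxy hd hb).map.rot ((f.galaxy hd hb).map.rot (.inr (x, k))) ≠ .inr (x, k) ↔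
      f.τ (finRotate _ k) (firstStep f.σ₁ (finRotate _ k) x) ≠
        firstStep f.σ₁ (finRotate _ k) x := fun x k => by
    change (monodromyMap f.σ₁ f.τ).rot ((monodromyMap f.σ₁ f.τ).rot (.inr (x, k))) ≠ _ ↔ _
    simp only [monodromyMap, OrientedMap.ofFaces_rot_inr, OrientedMap.ofFaces_rot_inl, ne_eq,
      Sum.inr.injEq, Perm.inv_eq_iff_eq]
    simp only [towerPerm_apply, Prod.mk.injEq, and_true, Perm.mul_apply]
  constructor
  · rintro ⟨p | ⟨x, k⟩, hi, he, hj⟩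
    · exact absurd (congrArg Sum.isLeft hi).symm Bool.false_ne_true
    · obtain rfl : finRotate _ k = j := hj
      rw [key, ← inv_apply_ne_iff] at he
      exact ⟨_, he, Sum.inr_injective ((f.dartFaceLabel_inr x k).symm.trans hi)⟩
  · rintro ⟨y, hy, rfl⟩
    obtain ⟨k, rfl⟩ := (finRotate _).surjective j
    obtain ⟨x, rfl⟩ := (partialProd f.σ₁ f.τ (finRotate _ k))⁻¹.surjective y
    obtain ⟨x, rfl⟩ := (firstStep f.σ₁ (finRotate _ k)).surjective x
    exact ⟨.inr (x, k), f.dartFaceLabel_inr x k,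
      (key x k).2 ((f.inv_apply_ne_iff _ _).1 hy), rfl⟩

theorem galaxy_isBiPruned_iff : (f.galaxy hd hb).IsBiPruned ↔ f.IsBiPruned := by
  rw [HurwitzGalaxy.isBiPruned_iff, Sum.forall]
  simp only [meets_inl_iff, meets_inr_iff]
  rfl

/-- A factorisation is determined by the map of its galaxy and the labels of the faces. -/
theorem eq_of_galaxy {f f' : Factorisation g μ ν} (hb : 0 < simpleCount g μ ν)
    (hrot : (monodromyMap f.σ₁ f.τ).rot = (monodromyMap f'.σ₁ f'.τ).rot)
    (hlabel : f.dartFaceLabel = f'.dartFaceLabel) : f = f' := by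
  let l : Fin (simpleCount g μ ν) := ⟨simpleCount g μ ν - 1, by omega⟩
  have hl : (finRotate _ l : ℕ) = 0 := by
    rw [val_finRotate, if_neg (by simp only [l]; omega)]
  have h1 : f.σ₁ = f'.σ₁ := Equiv.ext fun x => by
    have h : (monodromyMap f.σ₁ f.τ).next (.inl (x, l)) =
        (monodromyMap f'.σ₁ f'.τ).next (.inl (x, l)) := by
      rw [OrientedMap.next, OrientedMap.next, hrot]
      rfl
    simp only [monodromyMap, OrientedMap.ofFaces_next_inl, towerPerm_apply, firstStep,
      if_pos hl] at h
    exact congrArg Prod.fst (Sum.inl_injective h)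
  have h2 : f.τ = f'.τ := funext fun k => Equiv.ext fun x => by
    have h := monodromyMap_rot_rot f.σ₁ f.τ x k
    rw [hrot, monodromyMap_rot_rot] at h
    exact congrArg Prod.fst (Sum.inl_injective h).symm
  have h3 : f.σ₂ = f'.σ₂ := by rw [← f.prod_eq, ← f'.prod_eq, h1, h2]
  have h4 : f.label₁ = f'.label₁ := funext fun x =>
    Sum.inl_injective (congrFun hlabel (.inl (x, l)))
  have h5 : f.label₂ = f'.label₂ := funext fun x => by
    have h : (l : ℕ) + 1 = simpleCount g μ ν := Nat.sub_add_cancel hb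
    have := congrFun hlabel (.inr (f.σ₂ x, l))
    simp only [dartFaceLabel, monodromyFaceLabel, Sum.map_inr, h, partialProd_eq, ← h3,
      Sum.inr.injEq] at this
    simpa using this
  cases f
  cases f'
  simp_all

end Factorisation

/-! ### Isomorphisms from galaxies of factorisations, and numberings of the base -/

namespace HurwitzGalaxy

variable {d g : ℕ} {μ ν : Composition d} {hd : 0 < d} {hb : 0 < simpleCount g μ ν}

open Factorisation

/-- An isomorphism from the galaxy of a factorisation is determined by its values on the base. -/
theorem Iso.toEquiv_eq_of_base {G : HurwitzGalaxy g μ ν} {f f' : Factorisation g μ ν}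
    (φ : Iso (f.galaxy hd hb) G) (φ' : Iso (f'.galaxy hd hb) G)
    (h : ∀ x : Fin d, φ.toEquiv (.inl (x, G.lastLabel)) = φ'.toEquiv (.inl (x, G.lastLabel)))
    (e : GalaxyDart g μ ν) : φ.toEquiv e = φ'.toEquiv e := by
  have hnext : ∀ {f : Factorisation g μ ν} (x : Fin d) (k l : Fin (simpleCount g μ ν))
      (_ : (k : ℕ) + 1 = l), (monodromyMap f.σ₁ f.τ).next (.inl (x, k)) = .inl (x, l) :=
    fun x k l hkl => by
      have : finRotate _ k = l := Fin.ext (by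
        rw [val_finRotate, if_pos (by omega), hkl])
      rw [monodromyMap, OrientedMap.ofFaces_next_inl, towerPerm_apply, this, firstStep,
        if_neg (by omega)]
      rfl
  -- Induction on the distance `j` to the last copy: below it `next` is the same for `f` and `f'`,
  -- and `next` of `G` is injective.
  have hinl : ∀ (j : ℕ) (x : Fin d) (k : Fin (simpleCount g μ ν)),
      (k : ℕ) + j + 1 = simpleCount g μ ν →
      φ.toEquiv (.inl (x, k)) = φ'.toEquiv (.inl (x, k)) := fun j => by
    induction j with
    | zero =>
      intro x k hk
      obtain rfl : k = G.lastLabel := Fin.ext (by simp only [lastLabel]; omega)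
      exact h x
    | succ j ih =>
      intro x k hk
      have := ih x ⟨k + 1, by omega⟩ (by simp only; omega)
      have h1 := (congrArg φ.toEquiv (hnext (f := f) x k ⟨k + 1, by omega⟩ rfl)).trans
        (this.trans (congrArg φ'.toEquiv (hnext (f := f') x k ⟨k + 1, by omega⟩ rfl).symm))
      exact G.map.next.injective ((OrientedMap.map_next φ.map_rot φ.map_rev _).symm.trans
        (h1.trans (OrientedMap.map_next φ'.map_rot φ'.map_rev _)))
  have hinl' : ∀ p : Fin d × Fin (simpleCount g μ ν),
      φ.toEquiv (.inl p) = φ'.toEquiv (.inl p) := fun p =>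
    hinl (simpleCount g μ ν - 1 - p.2) p.1 p.2 (by omega)
  rcases e with p | p
  · exact hinl' p
  · exact (φ.map_rev (.inl p)).trans
      ((congrArg G.map.rev (hinl' p)).trans (φ'.map_rev (.inl p)).symm)

/-- The values on the base of an isomorphism from the galaxy of a factorisation. -/
noncomputable def Iso.onBase {G : HurwitzGalaxy g μ ν} {f : Factorisation g μ ν}
    (φ : Iso (f.galaxy hd hb) G) : Fin d ≃ G.Base :=
  Equiv.ofBijective (fun x => ⟨φ.toEquiv (.inl (x, G.lastLabel)), by
    constructor
    · exact (congrArg Sum.isLeft (φ.map_faceLabel _)).trans rfl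
    · have h : G.label (φ.toEquiv (.inl (x, G.lastLabel))) = G.lastLabel := φ.map_vertexLabel _
      rw [h]
      exact Nat.sub_add_cancel hb⟩) <| by
    refine Function.Injective.bijective_of_nat_card_le (fun x y h => ?_) ?_
    · have := φ.toEquiv.injective (congrArg Subtype.val h)
      exact congrArg Prod.fst (Sum.inl_injective this)
    · rw [G.card_base, Nat.card_fin]

/-- The values on the base determine the whole map on darts; pulling the rotation and the face
labels of `G` back along it then determines `f`. Every numbering arises from the monodromy it
defines. -/
theorem onBase_bijective (hd : 0 < d) (hb : 0 < simpleCount g μ ν) (G : HurwitzGalaxy g μ ν) :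
    Function.Bijective (fun p : Σ f : Factorisation g μ ν, Iso (f.galaxy hd hb) G =>
      p.2.onBase) := by
  constructor
  · rintro ⟨f, φ⟩ ⟨f', φ'⟩ h
    have key := φ.toEquiv_eq_of_base φ' fun x =>
      congrArg (fun β : Fin d ≃ G.Base => (β x).1) h
    obtain rfl : f = f' := eq_of_galaxy hb
      (Equiv.ext fun e => φ.toEquiv.injective (by
        refine (φ.map_rot e).trans (Eq.trans ?_ (key _).symm)
        rw [key e]
        exact (φ'.map_rot e).symm))
      (funext fun e => by
        have h1 := φ.map_faceLabel e
        rw [key e] at h1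
        exact h1.symm.trans (φ'.map_faceLabel e))
    obtain rfl : φ = φ' := Iso.ext (Equiv.ext key)
    rfl
  · intro β
    refine ⟨⟨G.factorisation β, G.factorisationIso β hd hb⟩, Equiv.ext fun x => Subtype.ext ?_⟩
    change G.dartOfBase (.inl (β x, G.lastLabel)) = (β x).1
    rw [dartOfBase_inl]
    simp [lastLabel]

instance (G H : HurwitzGalaxy g μ ν) : Finite (Iso G H) :=
  Finite.of_injective Iso.toEquiv fun _ _ h => Iso.ext h

theorem Iso.card_eq_autCard {G H : HurwitzGalaxy g μ ν} (φ : Iso G H) :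
    Nat.card (Iso G H) = H.autCard :=
  Nat.card_congr
    { toFun := fun ψ => φ.symm.trans ψ
      invFun := fun ψ => φ.trans ψ
      left_inv := fun ψ => by ext e; simp [Iso.trans, Iso.symm]
      right_inv := fun ψ => by ext e; simp [Iso.trans, Iso.symm] }

end HurwitzGalaxy

/-! ### Double counting -/

section Counting

variable {d g : ℕ} {μ ν : Composition d} (hd : 0 < d) (hb : 0 < simpleCount g μ ν)

/-- The isomorphism class of the galaxy of a bi-pruned factorisation. -/
noncomputable def galaxyClass (f : biPrunedFactorisations g μ ν) : BiPrunedClass g μ ν :=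
  Quotient.mk _ ⟨f.1.galaxy hd hb, (f.1.galaxy_isBiPruned_iff hd hb).2 f.2⟩

/-- Both sides count the pairs of a factorisation and an isomorphism from its galaxy to `G`: by
`onBase_bijective` on one side, by fibres that are torsors under `Aut G` on the other. -/
theorem card_galaxyClass_mul_autCard (q : BiPrunedClass g μ ν) :
    Nat.card {f // galaxyClass hd hb f = q} * q.autCard = d.factorial := by
  obtain ⟨G, rfl⟩ := Quotient.exists_rep q
  have hiff : ∀ f, galaxyClass hd hb f = Quotient.mk _ G ↔
      Nonempty (HurwitzGalaxy.Iso (f.1.galaxy hd hb) G.1) := fun f => Quotient.eq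
  have h1 := Nat.card_congr (Equiv.ofBijective _ (HurwitzGalaxy.onBase_bijective hd hb G.1))
  have h2 : Nat.card (Fin d ≃ G.1.Base) = d.factorial := by
    have e : Fin d ≃ G.1.Base :=
      (Finite.equivFinOfCardEq G.1.card_base).symm
    rw [← Nat.card_congr (Equiv.equivCongr (Equiv.refl (Fin d)) e), Nat.card_perm, Nat.card_fin]
  have e : (Σ f : Factorisation g μ ν, HurwitzGalaxy.Iso (f.galaxy hd hb) G.1) ≃
      Σ f : {f // galaxyClass hd hb f = Quotient.mk _ G},
        HurwitzGalaxy.Iso (f.1.1.galaxy hd hb) G.1 :=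
    -- A factorisation whose galaxy is isomorphic to the bi-pruned `G` is automatically bi-pruned.
    { toFun := fun p => ⟨⟨⟨p.1, (p.1.galaxy_isBiPruned_iff hd hb).1 (G.2.of_iso p.2.symm)⟩,
        (hiff _).2 ⟨p.2⟩⟩, p.2⟩
      invFun := fun p => ⟨p.1.1.1, p.2⟩
      left_inv := fun _ => rfl
      right_inv := fun _ => rfl }
  have := Fintype.ofFinite {f // galaxyClass hd hb f = Quotient.mk _ G}
  rw [← h2, ← h1, Nat.card_congr e, Nat.card_sigma]
  have hcard : ∀ f : {f // galaxyClass hd hb f = Quotient.mk _ G},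
      Nat.card (HurwitzGalaxy.Iso (f.1.1.galaxy hd hb) G.1) = G.1.autCard := fun f =>
    let ⟨φ⟩ := (hiff _).1 f.2
    φ.card_eq_autCard
  simp only [hcard]
  rw [Finset.sum_const, Finset.card_univ, smul_eq_mul, ← Nat.card_eq_fintype_card]
  rfl

end Counting

theorem mainTheorem3 {d : ℕ} (hd : 0 < d) (g : ℕ) (μ ν : Composition d) :
    biPrunedHurwitz g μ ν =
      (1 / (d.factorial : ℚ)) * (Set.ncard (biPrunedFactorisations g μ ν) : ℚ) := by
  rcases Nat.eq_zero_or_pos (simpleCount g μ ν) with hb | hb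
  -- For `b = 0` both sides vanish: a galaxy has a dart, whose origin needs a label in `Fin 0`, and
  -- bi-pruning the first cycle needs an index in `Fin 0`.
  · have h1 : IsEmpty (BiPrunedClass g μ ν) := ⟨fun q => by
      obtain ⟨G, -⟩ := Quotient.exists_rep q
      exact G.1.simpleCount_pos.ne' hb⟩
    have h2 : biPrunedFactorisations g μ ν = ∅ := by
      refine Set.eq_empty_of_forall_notMem fun f hf => ?_
      obtain ⟨j, -⟩ := hf.1 ⟨0, μ.length_pos_of_pos hd⟩
      exact j.pos.ne' hb
    rw [biPrunedHurwitz, h2]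
    simp
  · have hfac : (d.factorial : ℚ) ≠ 0 := by exact_mod_cast d.factorial_ne_zero
    have h1 : Set.ncard (biPrunedFactorisations g μ ν) =
        ∑ q, Nat.card {f // galaxyClass hd hb f = q} := by
      rw [← Nat.card_coe_set_eq, ← Nat.card_sigma]
      exact Nat.card_congr (Equiv.sigmaFiberEquiv (galaxyClass hd hb)).symm
    rw [biPrunedHurwitz, h1, Nat.cast_sum, Finset.mul_sum]
    refine Finset.sum_congr rfl fun q _ => ?_
    have h := card_galaxyClass_mul_autCard hd hb q
    have hq : (q.autCard : ℚ) ≠ 0 := by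
      intro h0
      rw [Nat.cast_eq_zero] at h0
      rw [h0, mul_zero] at h
      exact d.factorial_ne_zero h.symm
    rw [← h, Nat.cast_mul] at hfac ⊢
    have := left_ne_zero_of_mul hfac
    field_simp
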